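/- For $n\ge 1$ let $[n]=\{0,\dots,n-1\}$, and use variables $x_{i,j}$ for $i\neq j$ in $[n]$, where $x_{j,i}$ is identified with the literal $\overline{x}_{i,j}$ (so only the $x_{i,j}$ with $i<j$ are actual variables). For distinct $i,j,k$ let $T_{i,j,k}=\overline x_{i,j}\vee\overline x_{j,k}\vee\overline x_{k,i}$. Let $r,s:[n]^3\to[n]$ be functions such that, for all distinct $i,j,k$: $r(i,j,k)\ne s(i,j,k)$, $\{r(i,j,k),s(i,j,k)\}\not\subseteq\{i,j,k\}$, and $r(i,j,k)=r(j,k,i)$, $s(i,j,k)=s(j,k,i)$. The guarded graph tautology $\mathrm{GGT}_n$ (for $r,s$) is the set consisting of the clauses $\bigvee_{j\neq i}x_{j,i}$ for $i\in[n]$, and the clauses $T_{i,j,k}\vee x_{r(i,j,k),s(i,j,k)}$ and $T_{i,j,k}\vee\overline x_{r(i,j,k),s(i,j,k)}$ for all distinct $i,j,k\in[n]$. A regRTI refutation of a set $F$ of clauses is a binary tree with ordered children, whose nodes are labelled by clauses, such that: the root is labelled by the empty clause; each internal node is obtained from its two children, labelled $A$ and $B$, by the resolution rule, i.e. for some literal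 $y$ with $y\in A$, $\overline y\notin A$, $\overline y\in B$, $y\notin B$, it is labelled by $(A\setminus\{y\})\cup(B\setminus\{\overline y\})$; on each path from the root every variable is resolved on at most once; and each leaf is labelled either by a clause of $F$ or by an input lemma, i.e. a clause labelling a node that is earlier in the postorder of the tree and whose subtree is an input derivation (each inference in it has at least one premise that is a leaf of the tree). The size of the refutation is its number of nodes. **Theorem.** (1) There is a constant $K$ such that for all $n\ge1$ and all $r,s$ as above, $\mathrm{GGT}_n$ has a regRTI refutation of size at most $K n^7$. (2) Consequently, $\mathrm{GGT}_n$ is refuted by non-greedy DPLL with clause learning in polynomial size: there is a polynomial $p$ such that for all $n\ge1$ and all $r,s$ as above there is a run of size at most $p(n)$ of the following restart-free search procedure, started with the clauses $\Gamma=\mathrm{GGT}_n$ and the empty set $\alpha$ of decision literals, in which every branch ends in a conflict. In a call with current clauses $\Gamma$ and decisions $\alpha$, the procedure may, if unit propagation with $\Gamma$ starting from $\alpha$ falsifies a clause of $\Gamma$ (a conflict), add to $\Gamma$ finitely many learned clauses $C$, each having all its literals false under $\alpha$ and such that setting all literals of $C$ false already gives a conflict by unit propagation with $\Gamma$, and then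 backtrack; or it may (even if there is a conflict) choose a literal $y$ whose variable is not set by $\alpha$, call itself with $\alpha\cup\{y\}$, and then, with the clauses learned so far, with $\alpha\cup\{\overline y\}$. The size of a run is the number of calls plus the number of learned clauses. -/

import Mathlib

namespace GGTRes

/-! ### Literals and clauses -/

/-- A literal over the variables `V`: `(v, true)` is the variable `v`, `(v, false)` its negation. -/
abbrev Literal (V : Type) := V × Bool

/-- The complementary literal. -/
def Literal.neg {V : Type} (ℓ : Literal V) : Literal V := (ℓ.1, !ℓ.2)

/-- A clause is a finite set of literals, read as their disjunction; `∅` is the empty clause.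
A CNF formula is a `Set` of clauses. -/
abbrev Clause (V : Type) := Finset (Literal V)

/-! ### Resolution trees with input lemmas -/

/-- Binary trees with ordered children whose leaves are labelled by a clause and whose internal
nodes are labelled by a clause and a (resolution) literal. -/
inductive ResTree (V : Type) where
  | leaf (C : Clause V) : ResTree V
  | node (C : Clause V) (ℓ : Literal V) (left right : ResTree V) : ResTree V

namespace ResTree

variable {V : Type}

/-- The clause labelling the root. -/
def clause : ResTree V → Clause V
  | leaf C => C
  | node C _ _ _ => C

/-- The number of nodes of the tree, that is, of occurrences of clauses. -/
def size : ResTree V → ℕ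
  | leaf _ => 1
  | node _ _ l r => l.size + r.size + 1

/-- The tree consists of a single leaf. -/
def IsLeaf : ResTree V → Prop
  | leaf _ => True
  | node _ _ _ _ => False

/-- Every internal node is the resolvent of its children: for the label `ℓ`, the left premise `A`
contains `ℓ` and not its complement, the right premise `B` contains the complement of `ℓ` and
not `ℓ`, and the conclusion is `(A \ {ℓ}) ∪ (B \ {¬ℓ})`. -/
def InferencesCorrect [DecidableEq V] : ResTree V → Prop
  | leaf _ => True
  | node C ℓ l r =>
      (ℓ ∈ l.clause ∧ ℓ.neg ∉ l.clause ∧ ℓ.neg ∈ r.clause ∧ ℓ ∉ r.clause ∧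
        C = l.clause.erase ℓ ∪ r.clause.erase ℓ.neg) ∧
      l.InferencesCorrect ∧ r.InferencesCorrect

/-- The set of variables that are resolved on somewhere in the tree. -/
def resolvedVars : ResTree V → Set V
  | leaf _ => ∅
  | node _ ℓ l r => insert ℓ.1 (l.resolvedVars ∪ r.resolvedVars)

/-- On every path each variable is resolved on at most once. -/
def RegularPaths : ResTree V → Prop
  | leaf _ => True
  | node _ ℓ l r =>
      (ℓ.1 ∉ l.resolvedVars ∧ ℓ.1 ∉ r.resolvedVars) ∧ l.RegularPaths ∧ r.RegularPaths

/-- Input derivation: every inference has at least one premise that is a leaf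
(an initial clause or a lemma). -/
def IsInput : ResTree V → Prop
  | leaf _ => True
  | node _ _ l r => (l.IsLeaf ∨ r.IsLeaf) ∧ l.IsInput ∧ r.IsInput

/-- The clauses that label an internal node whose subtree is an input derivation. -/
def inputClauses : ResTree V → Set (Clause V)
  | leaf _ => ∅
  | node C ℓ l r =>
      l.inputClauses ∪ r.inputClauses ∪ {D | D = C ∧ (node C ℓ l r).IsInput}

/-- Every leaf is labelled by a clause of `F` or by an input lemma. Here `L` is the set of input
lemmas that are available before the tree is entered; a leaf may use as lemma a clause of `L`, or a
clause that is derived by an input subderivation and comes earlier in the postorder. The nodes of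
the tree that come before a given leaf in the postorder are those in the left subtrees hanging off
the path to this leaf. -/
def LeavesCorrect (F : Set (Clause V)) : Set (Clause V) → ResTree V → Prop
  | L, leaf C => C ∈ F ∨ C ∈ L
  | L, node _ _ l r => l.LeavesCorrect F L ∧ r.LeavesCorrect F (L ∪ l.inputClauses)

/-- `T` is a regRTI refutation of `F`: a tree-like regular resolution refutation
all of whose lemmas are input lemmas. -/
structure IsRegRTIRefutation [DecidableEq V] (F : Set (Clause V)) (T : ResTree V) : Prop where
  leaves : T.LeavesCorrect F ∅
  inferences : T.InferencesCorrect
  regular : T.RegularPaths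
  root : T.clause = ∅

end ResTree

/-! ### Non-greedy DPLL search with clause learning by unit propagation -/

/-- `UnitImplied Γ α ℓ`: starting from the literals in `α` being true, unit propagation with the
clauses of `Γ` sets the literal `ℓ` true. -/
inductive UnitImplied {V : Type} (Γ : Set (Clause V)) (α : Finset (Literal V)) : Literal V → Prop
  | assumed {ℓ : Literal V} (h : ℓ ∈ α) : UnitImplied Γ α ℓ
  | unit {C : Clause V} {ℓ : Literal V} (hC : C ∈ Γ) (hℓ : ℓ ∈ C)
      (h : ∀ m ∈ C, m ≠ ℓ → UnitImplied Γ α m.neg) : UnitImplied Γ α ℓ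

/-- Unit propagation with `Γ` from `α` falsifies some clause of `Γ`. -/
def UnitConflict {V : Type} (Γ : Set (Clause V)) (α : Finset (Literal V)) : Prop :=
  ∃ C ∈ Γ, ∀ ℓ ∈ C, UnitImplied Γ α ℓ.neg

/-- The clause `C` can be learned when the decisions are `α` and the current clauses are `Γ`:
all literals of `C` are false under `α`, and setting the literals of `C` false
already yields a conflict by unit propagation. -/
def Learnable {V : Type} [DecidableEq V] (Γ : Set (Clause V)) (α : Finset (Literal V))
    (C : Clause V) : Prop :=
  (∀ ℓ ∈ C, ℓ.neg ∈ α) ∧ UnitConflict Γ (C.image Literal.neg)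

/-- The recursion tree of a DPLL search, without restarts, that never meets a satisfying assignment.
At `conflict D` the search has found a conflict, learns the clauses in `D` and backtracks.
At `branch ℓ first second` it first sets `ℓ` true and, after backtracking, sets `ℓ` false. -/
inductive Search (V : Type) where
  | conflict (D : Finset (Clause V)) : Search V
  | branch (ℓ : Literal V) (first second : Search V) : Search V

namespace Search

variable {V : Type}

/-- The number of recursive calls plus the number of clauses learned. -/
def size : Search V → ℕ
  | conflict D => D.card + 1
  | branch _ s t => s.size + t.size + 1

/-- The current clauses (initial and learned) after a search that is started with `Γ`. -/
def clausesAfter : Search V → Set (Clause V) → Set (Clause V)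
  | conflict D, Γ => Γ ∪ {C | C ∈ D}
  | branch _ s t, Γ => t.clausesAfter (s.clausesAfter Γ)

/-- The search, started with current clauses `Γ` and with the decision literals `α` set true, is
carried out correctly and ends with the answer that there is no satisfying assignment extending `α`.
Branching on an unassigned variable is always allowed, also when there is a
conflict: the search is non-greedy. -/
def Refutes [DecidableEq V] : Search V → Set (Clause V) → Finset (Literal V) → Prop
  | conflict D, Γ, α => UnitConflict Γ α ∧ ∀ C ∈ D, Learnable Γ α C
  | branch ℓ s t, Γ, α =>
      (ℓ ∉ α ∧ ℓ.neg ∉ α) ∧ s.Refutes Γ (insert ℓ α) ∧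
        t.Refutes (s.clausesAfter Γ) (insert ℓ.neg α)

end Search

/-! ### Guarded graph tautologies -/

/-- The variables `x_{i,j}` with `i < j` in `[n]`. -/
abbrev Edge (n : ℕ) := {p : Fin n × Fin n // p.1 < p.2}

/-- The literal `x_{i,j}` for distinct `i, j`; for `j < i` it is the negation of `x_{j,i}`. -/
def x {n : ℕ} (i j : Fin n) (h : i ≠ j) : Literal (Edge n) :=
  if hlt : i < j then (⟨(i, j), hlt⟩, true)
  else (⟨(j, i), lt_of_le_of_ne (not_lt.mp hlt) h.symm⟩, false)

theorem neg_x {n : ℕ} (i j : Fin n) (h : i ≠ j) : (x i j h).neg = x j i h.symm := by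
  rcases lt_or_gt_of_ne h with hlt | hlt
  · simp [x, Literal.neg, hlt, not_lt.mpr hlt.le]
  · simp [x, Literal.neg, hlt, not_lt.mpr hlt.le]

/-- The clause `⋁_{j ≠ i} x_{j,i}`: some `j` precedes `i`. -/
def notMinimal {n : ℕ} (i : Fin n) : Clause (Edge n) :=
  (Finset.univ : Finset {j : Fin n // j ≠ i}).image fun j => x j.1 i j.2

/-- The transitivity clause `T_{i,j,k} = ¬x_{i,j} ∨ ¬x_{j,k} ∨ ¬x_{k,i}`. -/
def trans {n : ℕ} (i j k : Fin n) (hij : i ≠ j) (hjk : j ≠ k) (hki : k ≠ i) : Clause (Edge n) :=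
  {(x i j hij).neg, (x j k hjk).neg, (x k i hki).neg}

/-- Admissible guard functions `r, s : [n]³ → [n]`; only their values at
triples of distinct elements matter. -/
structure Guards (n : ℕ) where
  r : Fin n → Fin n → Fin n → Fin n
  s : Fin n → Fin n → Fin n → Fin n
  ne : ∀ i j k, i ≠ j → j ≠ k → k ≠ i → r i j k ≠ s i j k
  not_subset : ∀ i j k, i ≠ j → j ≠ k → k ≠ i →
    ¬ (({r i j k, s i j k} : Set (Fin n)) ⊆ {i, j, k})
  r_cyclic : ∀ i j k, i ≠ j → j ≠ k → k ≠ i → r i j k = r j k i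
  s_cyclic : ∀ i j k, i ≠ j → j ≠ k → k ≠ i → s i j k = s j k i

/-- The guarded graph tautology `GGT_n` for the guard functions `g`. -/
def GGT {n : ℕ} (g : Guards n) : Set (Clause (Edge n)) :=
  {C | (∃ i, C = notMinimal i) ∨
    ∃ (i j k : Fin n) (hij : i ≠ j) (hjk : j ≠ k) (hki : k ≠ i),
      C = insert (x (g.r i j k) (g.s i j k) (g.ne i j k hij hjk hki)) (trans i j k hij hjk hki) ∨
      C = insert (x (g.r i j k) (g.s i j k) (g.ne i j k hij hjk hki)).neg
        (trans i j k hij hjk hki)}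

end GGTRes

namespace GGTRes

/-! The refutation follows a partial tournament `α`, whose arcs are the literals set so far. Its
derived clause is falsified by `α`, and it is required to contain the literals of all arcs out of
sources (`SolvesUnder`). This replaces weakening: a branching literal is present in both premises
because its arc leaves a source or lies on a triangle refuted by its own transitivity clause.
Coverage, i.e. every non-source succeeds a source, makes few transitivity clauses suffice: those on
three sources, and those on `a, b, c` with sources `a`, `c` and an arc from `a` to `b` but none from
`c` to `b`.

If all of these are available, as lemmas or with a guard literal falsified by `α`, the classical
short proof of the ordering principle works. From "some source below `k + 1` precedes `i`" and the
same clause for `k`, transitivity gives "some source below `k` precedes `i`"; at the least source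
`i` nothing is left but falsified literals. The tree reuses these clauses as input lemmas, so the
size is `O(n ^ 4)` (`exists_derivesLayer`, `IsReady.exists_solvesUnder`).

If some needed clause is not available, branching on two or three arcs produces the triangle in one
branch. The guard must be unset there: its edge does not lie inside the triangle, so if it were set,
it would have been set before and the clause would be available. Hence the two guarded versions
resolve to the bare transitivity clause, an input lemma. The other branches regain coverage by at
most `n` shortcut arcs and are solved recursively. There are at most `n ^ 3` such lemmas, and a
potential of `B = O(n ^ 4)` per unlearned one pays for everything (`canSolve_of_forall_available`),
which gives `O(n ^ 7)`.

For the second claim, a search branches along the refutation (`ResTree.exists_search`). Falsifying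
the conclusion of an input derivation gives a conflict by unit propagation, so input lemmas can be
learned. -/

theorem Literal.neg_neg {V : Type} (ℓ : Literal V) : ℓ.neg.neg = ℓ := by
  simp [Literal.neg]

/-! ### Simulation of regular trees with input lemmas by clause learning -/

namespace ResTree

variable {V : Type}

theorem LeavesCorrect.mono {F : Set (Clause V)} : ∀ {t : ResTree V} {L L' : Set (Clause V)},
    L ⊆ L' → t.LeavesCorrect F L → t.LeavesCorrect F L'
  | leaf _, _, _, h, ht => ht.imp id (@h _)
  | node _ _ _ _, _, _, h, ht =>
    ⟨ht.1.mono h, ht.2.mono (Set.union_subset_union_left _ h)⟩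

/-- The clauses labelling the leaves. -/
def leafClauses : ResTree V → Set (Clause V)
  | leaf C => {C}
  | node _ _ l r => l.leafClauses ∪ r.leafClauses

theorem IsLeaf.eq_leaf {t : ResTree V} (h : t.IsLeaf) : t = leaf t.clause := by
  cases t with
  | leaf C => rfl
  | node C ℓ l r => exact h.elim

theorem IsInput.clause_mem {t : ResTree V} (h : t.IsInput) (hl : ¬ t.IsLeaf) :
    t.clause ∈ t.inputClauses := by
  cases t with
  | leaf C => exact (hl trivial).elim
  | node C ℓ l r => exact Or.inr ⟨rfl, h⟩

end ResTree

variable {V : Type}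

theorem UnitImplied.cut {Γ : Set (Clause V)} {α β : Finset (Literal V)} {m : Literal V}
    (h : UnitImplied Γ β m) (hβ : ∀ b ∈ β, UnitImplied Γ α b) : UnitImplied Γ α m := by
  induction h with
  | assumed h => exact hβ _ h
  | unit hC hℓ _ ih => exact .unit hC hℓ ih

theorem UnitConflict.cut {Γ : Set (Clause V)} {α β : Finset (Literal V)}
    (h : UnitConflict Γ β) (hβ : ∀ b ∈ β, UnitImplied Γ α b) : UnitConflict Γ α := by
  obtain ⟨C, hC, h⟩ := h
  exact ⟨C, hC, fun ℓ hℓ => (h ℓ hℓ).cut hβ⟩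

namespace Search

/-- The current clauses at the last conflict of a search started with `Γ`. -/
def lastClauses : Search V → Set (Clause V) → Set (Clause V)
  | conflict _, Γ => Γ
  | branch _ s t, Γ => t.lastClauses (s.clausesAfter Γ)

theorem subset_clausesAfter : ∀ (S : Search V) (Γ : Set (Clause V)), Γ ⊆ S.clausesAfter Γ
  | conflict _, _ => Set.subset_union_left
  | branch _ s t, Γ => (s.subset_clausesAfter Γ).trans (t.subset_clausesAfter _)

theorem subset_lastClauses : ∀ (S : Search V) (Γ : Set (Clause V)), Γ ⊆ S.lastClauses Γ
  | conflict _, _ => subset_rfl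
  | branch _ s t, Γ => (s.subset_clausesAfter Γ).trans (t.subset_lastClauses _)

theorem lastClauses_subset : ∀ (S : Search V) (Γ : Set (Clause V)),
    S.lastClauses Γ ⊆ S.clausesAfter Γ
  | conflict _, _ => Set.subset_union_left
  | branch _ _ t, _ => t.lastClauses_subset _

end Search

variable [DecidableEq V]

/-- Resolving with a clause `A` of `Γ` is one unit propagation: once `C` is false, `A` forces `ℓ`,
which falsifies the one literal of `B` that may be missing from `C`. -/
theorem UnitConflict.of_resolve {Γ : Set (Clause V)} {A B : Clause V} {ℓ : Literal V}
    (hA : A ∈ Γ) (hℓ : ℓ ∈ A) (hB : UnitConflict Γ (B.image Literal.neg)) {C : Clause V}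
    (hAC : A.erase ℓ ⊆ C) (hBC : B.erase ℓ.neg ⊆ C) :
    UnitConflict Γ (C.image Literal.neg) := by
  refine hB.cut fun b hb => ?_
  obtain ⟨m, hm, rfl⟩ := Finset.mem_image.1 hb
  by_cases h : m = ℓ.neg
  · subst h
    rw [Literal.neg_neg]
    exact .unit hA hℓ fun m hm hne =>
      .assumed (Finset.mem_image_of_mem _ (hAC (Finset.mem_erase.2 ⟨hne, hm⟩)))
  · exact .assumed (Finset.mem_image_of_mem _ (hBC (Finset.mem_erase.2 ⟨h, hm⟩)))

/-- Falsifying the conclusion of an input derivation yields a conflict by unit propagation with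
the clauses at its leaves. -/
theorem ResTree.IsInput.unitConflict {Γ : Set (Clause V)} : ∀ {t : ResTree V}, t.IsInput →
    t.InferencesCorrect → t.leafClauses ⊆ Γ → UnitConflict Γ (t.clause.image Literal.neg)
  | .leaf C, _, _, hΓ =>
    ⟨C, hΓ rfl, fun _ hℓ => .assumed (Finset.mem_image_of_mem _ hℓ)⟩
  | .node C ℓ l r, ⟨hlr, hl, hr⟩, ⟨⟨h1, _, h3, _, hC⟩, il, ir⟩, hΓ => by
    have hΓl : l.leafClauses ⊆ Γ := Set.subset_union_left.trans hΓ
    have hΓr : r.leafClauses ⊆ Γ := Set.subset_union_right.trans hΓ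
    subst hC
    rcases hlr with h | h
    · refine .of_resolve (A := l.clause) ?_ h1 (hr.unitConflict ir hΓr)
        Finset.subset_union_left Finset.subset_union_right
      rw [h.eq_leaf] at hΓl
      exact hΓl rfl
    · refine .of_resolve (A := r.clause) ?_ h3 (hl.unitConflict il hΓl)
        Finset.subset_union_right ?_
      · rw [h.eq_leaf] at hΓr
        exact hΓr rfl
      · rw [Literal.neg_neg]
        exact Finset.subset_union_left

namespace Search

/-- Additionally learn `C` at the last conflict. -/
def learnLast (C : Clause V) : Search V → Search V
  | conflict D => conflict (insert C D)
  | branch ℓ s t => branch ℓ s (t.learnLast C)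

theorem lastClauses_learnLast (C : Clause V) : ∀ (S : Search V) (Γ : Set (Clause V)),
    (S.learnLast C).lastClauses Γ = S.lastClauses Γ
  | conflict _, _ => rfl
  | branch _ _ t, _ => lastClauses_learnLast C t _

theorem clausesAfter_learnLast (C : Clause V) : ∀ (S : Search V) (Γ : Set (Clause V)),
    (S.learnLast C).clausesAfter Γ = insert C (S.clausesAfter Γ)
  | conflict D, Γ => by
    ext E
    simp [learnLast, clausesAfter, or_left_comm]
  | branch _ _ t, _ => clausesAfter_learnLast C t _

theorem size_learnLast (C : Clause V) : ∀ S : Search V, (S.learnLast C).size ≤ S.size + 1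
  | conflict D => by
    have := Finset.card_insert_le C D
    simp only [learnLast, size]
    omega
  | branch _ s t => by
    have := size_learnLast C t
    simp only [learnLast, size]
    omega

theorem Refutes.learnLast {C : Clause V} : ∀ {S : Search V} {Γ : Set (Clause V)}
    {α : Finset (Literal V)}, S.Refutes Γ α → (∀ ℓ ∈ C, ℓ.neg ∈ α) →
    UnitConflict (S.lastClauses Γ) (C.image Literal.neg) → (S.learnLast C).Refutes Γ α
  | conflict D, Γ, α, h, hα, hC => by
    refine ⟨h.1, fun E hE => ?_⟩
    rcases Finset.mem_insert.1 hE with rfl | hE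
    · exact ⟨hα, hC⟩
    · exact h.2 E hE
  | branch ℓ s t, Γ, α, h, hα, hC =>
    ⟨h.1, h.2.1, h.2.2.learnLast (fun m hm => Finset.mem_insert_of_mem (hα m hm)) hC⟩

end Search

/-- A regular tree with input lemmas is simulated by a search that branches along the tree and
learns the input lemmas. -/
theorem ResTree.exists_search {F : Set (Clause V)} : ∀ (t : ResTree V) {L Γ : Set (Clause V)}
    {α : Finset (Literal V)}, F ⊆ Γ → L ⊆ Γ → t.LeavesCorrect F L → t.InferencesCorrect →
    t.RegularPaths → (∀ ℓ ∈ α, ℓ.1 ∉ t.resolvedVars) → (∀ ℓ ∈ t.clause, ℓ.neg ∈ α) →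
    ∃ S : Search V, S.Refutes Γ α ∧ S.size ≤ 2 * t.size ∧
      t.inputClauses ⊆ S.clausesAfter Γ ∧ t.leafClauses ⊆ S.lastClauses Γ
  | .leaf C, L, Γ, α, hF, hL, hlv, _, _, _, hα => by
    have hC : C ∈ Γ := hlv.elim (@hF _) (@hL _)
    refine ⟨.conflict ∅, ⟨⟨C, hC, fun ℓ hℓ => .assumed (hα ℓ hℓ)⟩, by simp⟩, by
      simp [Search.size, ResTree.size], Set.empty_subset _, ?_⟩
    rintro D rfl
    exact hC
  | .node C ℓ l r, L, Γ, α, hF, hL, hlv, hinf, hreg, hv, hα => by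
    obtain ⟨⟨h1, h2, h3, h4, rfl⟩, il, ir⟩ := hinf
    obtain ⟨⟨hℓl, hℓr⟩, rl, rr⟩ := hreg
    -- The left premise contains `ℓ`, so it is false after deciding `ℓ.neg`; by regularity the
    -- decided variable is not resolved on again below.
    obtain ⟨S, hS, sS, iS, fS⟩ := l.exists_search (α := insert ℓ.neg α) hF hL hlv.1 il rl
      (fun m hm => by
        rcases Finset.mem_insert.1 hm with rfl | hm
        · exact hℓl
        · exact fun h => hv m hm (Or.inr (Or.inl h)))
      (fun m hm => by
        by_cases h : m = ℓ
        · rw [h]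
          exact Finset.mem_insert_self _ _
        · exact Finset.mem_insert_of_mem
            (hα m (Finset.mem_union_left _ (Finset.mem_erase.2 ⟨h, hm⟩))))
    have cS := S.subset_clausesAfter Γ
    obtain ⟨U, hU, sU, iU, fU⟩ := r.exists_search (α := insert ℓ α)
      (hF.trans cS) (Set.union_subset (hL.trans cS) iS) hlv.2 ir rr
      (fun m hm => by
        rcases Finset.mem_insert.1 hm with rfl | hm
        · exact hℓr
        · exact fun h => hv m hm (Or.inr (Or.inr h)))
      (fun m hm => by
        by_cases h : m = ℓ.neg
        · rw [h, Literal.neg_neg]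
          exact Finset.mem_insert_self _ _
        · exact Finset.mem_insert_of_mem
            (hα m (Finset.mem_union_right _ (Finset.mem_erase.2 ⟨h, hm⟩))))
    have cU := U.subset_clausesAfter (S.clausesAfter Γ)
    have hℓα : ℓ ∉ α := fun h => hv ℓ h (Or.inl rfl)
    have hnα : ℓ.neg ∉ α := fun h => hv ℓ.neg h (Or.inl rfl)
    have hR : (Search.branch ℓ.neg S U).Refutes Γ α :=
      ⟨⟨hnα, by rwa [Literal.neg_neg]⟩, hS, by rwa [Literal.neg_neg]⟩
    have hafter : (Search.branch ℓ.neg S U).clausesAfter Γ = U.clausesAfter (S.clausesAfter Γ) :=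
      rfl
    -- At the last conflict below this node everything learned on the left is present, so all leaf
    -- clauses of the subtree are current. This is where its conclusion can be learned.
    have hleaf : (ResTree.node (l.clause.erase ℓ ∪ r.clause.erase ℓ.neg) ℓ l r).leafClauses ⊆
        (Search.branch ℓ.neg S U).lastClauses Γ :=
      Set.union_subset
        (fS.trans ((S.lastClauses_subset Γ).trans (U.subset_lastClauses _))) fU
    by_cases hin : (ResTree.node (l.clause.erase ℓ ∪ r.clause.erase ℓ.neg) ℓ l r).IsInput
    · refine ⟨(Search.branch ℓ.neg S U).learnLast (l.clause.erase ℓ ∪ r.clause.erase ℓ.neg),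
        hR.learnLast hα (hin.unitConflict ⟨⟨h1, h2, h3, h4, rfl⟩, il, ir⟩ hleaf), ?_, ?_, ?_⟩
      · refine (Search.size_learnLast _ _).trans ?_
        simp only [Search.size, ResTree.size]
        omega
      · rw [Search.clausesAfter_learnLast, hafter]
        rintro D ((hD | hD) | ⟨rfl, -⟩)
        · exact Or.inr (cU (iS hD))
        · exact Or.inr (iU hD)
        · exact Or.inl rfl
      · rwa [Search.lastClauses_learnLast]
    · refine ⟨.branch ℓ.neg S U, hR, ?_, ?_, hleaf⟩
      · simp only [Search.size, ResTree.size]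
        omega
      · rintro D ((hD | hD) | ⟨-, hD⟩)
        · exact cU (iS hD)
        · exact iU hD
        · exact (hin hD).elim

end GGTRes

namespace GGTRes

/-! ### Literals indexed by ordered pairs -/

section OrderLiterals

variable {V : Type} {n : ℕ}

/-- `X i j` is the literal "`i` precedes `j`"; the values on the diagonal are irrelevant. -/
structure OrderLiterals (X : Fin n → Fin n → Literal V) : Prop where
  neg : ∀ i j, i ≠ j → (X i j).neg = X j i
  inj : ∀ i j k l, i ≠ j → k ≠ l → X i j = X k l → i = k ∧ j = l

variable {X : Fin n → Fin n → Literal V}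

theorem OrderLiterals.fst_comm (hX : OrderLiterals X) {i j : Fin n} (h : i ≠ j) :
    (X i j).1 = (X j i).1 := by
  rw [← hX.neg i j h]
  rfl

theorem OrderLiterals.fst_eq (hX : OrderLiterals X) {i j k l : Fin n} (h : i ≠ j) (h' : k ≠ l)
    (e : (X i j).1 = (X k l).1) : i = k ∧ j = l ∨ i = l ∧ j = k := by
  by_cases hb : (X i j).2 = (X k l).2
  · exact Or.inl (hX.inj _ _ _ _ h h' (Prod.ext e hb))
  · refine Or.inr (hX.inj _ _ _ _ h h'.symm ?_)
    rw [← hX.neg k l h']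
    refine Prod.ext e ?_
    change _ = !(X k l).2
    revert hb
    cases (X i j).2 <;> cases (X k l).2 <;> simp

end OrderLiterals

variable {V : Type} [DecidableEq V]

/-! ### Regular derivations with input lemmas -/

/-- `t` is a regular derivation from the clauses in `F`, the lemmas in `L`, and its own input
lemmas. -/
structure ResTree.IsDerivation (F L : Set (Clause V)) (t : ResTree V) : Prop where
  leaves : t.LeavesCorrect F L
  inferences : t.InferencesCorrect
  regular : t.RegularPaths

/-- The tree whose last inference resolves the roots of `l` and `r` on `ℓ`. -/
def ResTree.resolve (ℓ : Literal V) (l r : ResTree V) : ResTree V :=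
  .node (l.clause.erase ℓ ∪ r.clause.erase ℓ.neg) ℓ l r

theorem ResTree.IsDerivation.of_mem {F L : Set (Clause V)} {C : Clause V} (h : C ∈ F ∨ C ∈ L) :
    IsDerivation F L (.leaf C) :=
  ⟨h, trivial, trivial⟩

theorem ResTree.IsDerivation.resolve {F L : Set (Clause V)} {l r : ResTree V} {ℓ : Literal V}
    (hl : l.IsDerivation F L) (hr : r.IsDerivation F (L ∪ l.inputClauses))
    (h1 : ℓ ∈ l.clause) (h2 : ℓ.neg ∉ l.clause) (h3 : ℓ.neg ∈ r.clause) (h4 : ℓ ∉ r.clause)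
    (hvl : ℓ.1 ∉ l.resolvedVars) (hvr : ℓ.1 ∉ r.resolvedVars) :
    (ResTree.resolve ℓ l r).IsDerivation F L :=
  ⟨⟨hl.leaves, hr.leaves⟩, ⟨⟨h1, h2, h3, h4, rfl⟩, hl.inferences, hr.inferences⟩,
    ⟨hvl, hvr⟩, hl.regular, hr.regular⟩

theorem ResTree.inputClauses_resolve_left (ℓ : Literal V) (l r : ResTree V) :
    l.inputClauses ⊆ (resolve ℓ l r).inputClauses :=
  fun _ h => Or.inl (Or.inl h)

theorem ResTree.inputClauses_resolve_right (ℓ : Literal V) (l r : ResTree V) :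
    r.inputClauses ⊆ (resolve ℓ l r).inputClauses :=
  fun _ h => Or.inl (Or.inr h)

variable {n : ℕ} {X : Fin n → Fin n → Literal V}

theorem OrderLiterals.mem_resolve (hX : OrderLiterals X) {u v c d : Fin n} (huv : u ≠ v)
    (hcd : c ≠ d) (l r : ResTree V) :
    X c d ∈ (ResTree.resolve (X u v) l r).clause ↔
      (X c d ∈ l.clause ∧ ¬ (c = u ∧ d = v)) ∨ (X c d ∈ r.clause ∧ ¬ (c = v ∧ d = u)) := by
  have key : ∀ {u v : Fin n}, u ≠ v → (X c d = X u v ↔ c = u ∧ d = v) := fun huv =>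
    ⟨hX.inj _ _ _ _ hcd huv, by rintro ⟨rfl, rfl⟩; rfl⟩
  simp only [ResTree.resolve, ResTree.clause, Finset.mem_union, Finset.mem_erase,
    hX.neg u v huv, ne_eq, key huv, key huv.symm]
  tauto

/-! ### Partial tournaments -/

/-- `i` is a source of the directed graph `α`. -/
def IsSource (α : Fin n → Fin n → Prop) (i : Fin n) : Prop := ∀ j, ¬ α j i

/-- The graph `α` with the additional arc from `u` to `v`. -/
def addArc (α : Fin n → Fin n → Prop) (u v i j : Fin n) : Prop := α i j ∨ (i = u ∧ j = v)

/-- Every vertex that is not a source is a successor of a source. -/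
def IsCovered (α : Fin n → Fin n → Prop) : Prop :=
  ∀ j, IsSource α j ∨ ∃ p, IsSource α p ∧ α p j

/-- Every vertex can be reached from a source in at most two steps. -/
def IsWeaklyCovered (α : Fin n → Fin n → Prop) : Prop :=
  ∀ j, IsSource α j ∨ ∃ p, IsSource α p ∧ (α p j ∨ ∃ a, α p a ∧ α a j)

variable (X) in
/-- The transitivity clause that excludes the cycle `a, b, c`. -/
def cycleClause (a b c : Fin n) : Clause V := {X b a, X c b, X a c}

variable (X) in
/-- The abstract form of a guarded graph tautology. -/
structure GuardedTautology (F : Set (Clause V)) : Prop where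
  lits : OrderLiterals X
  notMinimal : ∀ i, ∃ C ∈ F, ∀ u v, u ≠ v → (X u v ∈ C ↔ v = i)
  guarded : ∀ a b c, a ≠ b → b ≠ c → c ≠ a → ∃ r s, r ≠ s ∧
    ¬ ((r = a ∨ r = b ∨ r = c) ∧ (s = a ∨ s = b ∨ s = c)) ∧
    insert (X r s) (cycleClause X a b c) ∈ F ∧ insert (X s r) (cycleClause X a b c) ∈ F

variable (X) in
/-- `t` derives a clause falsified by `α` without resolving on the variables set by `α`. -/
structure RefutesUnder (F L : Set (Clause V)) (α : Fin n → Fin n → Prop) (t : ResTree V) :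
    Prop extends t.IsDerivation F L where
  avoids : ∀ i j, i ≠ j → α i j → (X i j).1 ∉ t.resolvedVars
  falsified : ∀ i j, i ≠ j → X i j ∈ t.clause → α j i

variable (X) in
/-- The derived clause moreover contains all literals belonging to arcs out of sources. -/
structure SolvesUnder (F L : Set (Clause V)) (α : Fin n → Fin n → Prop) (t : ResTree V) :
    Prop extends RefutesUnder X F L α t where
  out_mem : ∀ i j, IsSource α i → α i j → X j i ∈ t.clause

variable (X) in
/-- Some available clause is the transitivity clause up to literals falsified by `α`. -/
def IsAvailable (F L : Set (Clause V)) (α : Fin n → Fin n → Prop) (a b c : Fin n) : Prop :=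
  ∃ D, (D ∈ F ∨ D ∈ L) ∧ cycleClause X a b c ⊆ D ∧
    ∀ u v, u ≠ v → X u v ∈ D → X u v ∈ cycleClause X a b c ∨ α v u

theorem OrderLiterals.mem_cycleClause (hX : OrderLiterals X) {a b c u v : Fin n} (hab : a ≠ b)
    (hbc : b ≠ c) (hca : c ≠ a) (huv : u ≠ v) :
    X u v ∈ cycleClause X a b c ↔ (u = b ∧ v = a) ∨ (u = c ∧ v = b) ∨ (u = a ∧ v = c) := by
  have key : ∀ {c d : Fin n}, c ≠ d → (X u v = X c d ↔ u = c ∧ v = d) := fun h =>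
    ⟨hX.inj _ _ _ _ huv h, by rintro ⟨rfl, rfl⟩; rfl⟩
  simp only [cycleClause, Finset.mem_insert, Finset.mem_singleton, key hab.symm, key hbc.symm,
    key hca.symm]

theorem IsAvailable.mono {F L L' : Set (Clause V)} {α : Fin n → Fin n → Prop} {a b c : Fin n}
    (h : IsAvailable X F L α a b c) (hL : L ⊆ L') : IsAvailable X F L' α a b c := by
  obtain ⟨D, hD, h⟩ := h
  exact ⟨D, hD.imp id (@hL _), h⟩

variable {F L : Set (Clause V)} {α : Fin n → Fin n → Prop}

/-- Combine the refutations below the two values of a variable. -/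
theorem RefutesUnder.branch (hX : OrderLiterals X) {u v : Fin n} {s t : ResTree V}
    (hs : RefutesUnder X F L (addArc α u v) s)
    (ht : RefutesUnder X F (L ∪ s.inputClauses) (addArc α v u) t) (huv : u ≠ v)
    (h1 : ¬ α u v) (h2 : ¬ α v u) (hms : X v u ∈ s.clause) (hmt : X u v ∈ t.clause) :
    RefutesUnder X F L α (.resolve (X v u) s t) := by
  have hnot_s : X u v ∉ s.clause := fun h => by
    rcases hs.falsified _ _ huv h with h | h
    · exact h2 h
    · exact huv h.1.symm
  have hnot_t : X v u ∉ t.clause := fun h => by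
    rcases ht.falsified _ _ huv.symm h with h | h
    · exact h1 h
    · exact huv h.1
  have hneg := hX.neg v u huv.symm
  refine ⟨hs.toIsDerivation.resolve ht.toIsDerivation hms (by rwa [hneg]) (by rwa [hneg]) hnot_t
    ?_ ?_, ?_, ?_⟩
  · rw [hX.fst_comm huv.symm]
    exact hs.avoids u v huv (Or.inr ⟨rfl, rfl⟩)
  · exact ht.avoids v u huv.symm (Or.inr ⟨rfl, rfl⟩)
  · rintro i j hne hij (h | h | h)
    · rcases hX.fst_eq hne huv.symm h with ⟨rfl, rfl⟩ | ⟨rfl, rfl⟩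
      · exact h2 hij
      · exact h1 hij
    · exact hs.avoids i j hne (Or.inl hij) h
    · exact ht.avoids i j hne (Or.inl hij) h
  · intro i j hij h
    rcases (hX.mem_resolve huv.symm hij s t).1 h with ⟨h, hne⟩ | ⟨h, hne⟩
    · rcases hs.falsified _ _ hij h with h | h
      · exact h
      · exact (hne ⟨h.2, h.1⟩).elim
    · rcases ht.falsified _ _ hij h with h | h
      · exact h
      · exact (hne ⟨h.2, h.1⟩).elim

end GGTRes

/-! ### Refuting triangles, the potential, and restoring coverage -/

namespace GGTRes

variable {V : Type} [DecidableEq V] {n : ℕ} {X : Fin n → Fin n → Literal V}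
  {F L : Set (Clause V)} {α : Fin n → Fin n → Prop}

/-- A directed triangle in `α` is refuted directly. If no version of its transitivity clause is
available, then that clause is derived as an input lemma. -/
theorem GuardedTautology.exists_refutesUnder (hF : GuardedTautology X F)
    {β : Fin n → Fin n → Prop} {a b c : Fin n}
    (hα : ∀ i j, α i j → β i j ∨ ((i = a ∨ i = b ∨ i = c) ∧ (j = a ∨ j = b ∨ j = c)))
    (hab : a ≠ b) (hbc : b ≠ c) (hca : c ≠ a) (h1 : α a b) (h2 : α b c) (h3 : α c a)
    (L : Set (Clause V)) :
    ∃ t, RefutesUnder X F L α t ∧ t.size ≤ 3 ∧ cycleClause X a b c ⊆ t.clause ∧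
      (¬ IsAvailable X F L β a b c → cycleClause X a b c ∈ t.inputClauses) := by
  have hX := hF.lits
  have hT : ∀ i j, i ≠ j → X i j ∈ cycleClause X a b c → α j i := by
    intro i j hij h
    rcases (hX.mem_cycleClause hab hbc hca hij).1 h with ⟨rfl, rfl⟩ | ⟨rfl, rfl⟩ | ⟨rfl, rfl⟩ <;>
      assumption
  have hleaf : ∀ D, (D ∈ F ∨ D ∈ L) → (∀ u v, u ≠ v → X u v ∈ D → α v u) →
      RefutesUnder X F L α (.leaf D) :=
    fun D hD h => ⟨.of_mem hD, fun _ _ _ _ h => h, h⟩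
  by_cases hL : cycleClause X a b c ∈ L
  · exact ⟨.leaf _, hleaf _ (Or.inr hL) hT, by simp [ResTree.size], subset_rfl,
      fun h => (h ⟨_, Or.inr hL, subset_rfl, fun _ _ _ h => Or.inl h⟩).elim⟩
  obtain ⟨r, s, hrs, hnot, hr, hs⟩ := hF.guarded a b c hab hbc hca
  -- If `α` sets the guard variable, so does `β`, because the ends of the guard are not both in the
  -- triangle. The guarded clause used as a leaf then counts as available under `β`.
  have key : ∀ r s, r ≠ s → ¬ ((r = a ∨ r = b ∨ r = c) ∧ (s = a ∨ s = b ∨ s = c)) →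
      insert (X r s) (cycleClause X a b c) ∈ F → α s r →
      ∃ t, RefutesUnder X F L α t ∧ t.size ≤ 3 ∧ cycleClause X a b c ⊆ t.clause ∧
      (¬ IsAvailable X F L β a b c → cycleClause X a b c ∈ t.inputClauses) := by
    intro r s hrs hnot hr hsr
    have hD : ∀ u v, u ≠ v → X u v ∈ insert (X r s) (cycleClause X a b c) →
        X u v ∈ cycleClause X a b c ∨ u = r ∧ v = s := by
      intro u v huv h
      rcases Finset.mem_insert.1 h with h | h
      · exact Or.inr (hX.inj _ _ _ _ huv hrs h)
      · exact Or.inl h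
    refine ⟨.leaf _, hleaf _ (Or.inl hr) ?_, by simp [ResTree.size], Finset.subset_insert _ _,
      fun h => (h ⟨_, Or.inl hr, Finset.subset_insert _ _, ?_⟩).elim⟩
    · intro u v huv h
      rcases hD u v huv h with h | ⟨rfl, rfl⟩
      · exact hT u v huv h
      · exact hsr
    · intro u v huv h
      rcases hD u v huv h with h | ⟨rfl, rfl⟩
      · exact Or.inl h
      · exact Or.inr ((hα _ _ hsr).resolve_right fun h => hnot h.symm)
  by_cases hsr : α s r
  · exact key r s hrs hnot hr hsr
  by_cases hrs' : α r s
  · exact key s r hrs.symm (fun h => hnot h.symm) hs hrs'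
  have hcyc : ∀ r s, r ≠ s → ¬ ((r = a ∨ r = b ∨ r = c) ∧ (s = a ∨ s = b ∨ s = c)) →
      X r s ∉ cycleClause X a b c := by
    intro r s hrs hnot h
    rcases (hX.mem_cycleClause hab hbc hca hrs).1 h with ⟨rfl, rfl⟩ | ⟨rfl, rfl⟩ | ⟨rfl, rfl⟩ <;>
      simp at hnot
  have hfalse : ∀ r s, r ≠ s → insert (X s r) (cycleClause X a b c) ∈ F →
      ∀ L, RefutesUnder X F L (addArc α r s) (.leaf (insert (X s r) (cycleClause X a b c))) := by
    intro r s hrs hs L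
    refine ⟨.of_mem (Or.inl hs), fun _ _ _ _ h => h, fun i j hij h => ?_⟩
    rcases Finset.mem_insert.1 h with h | h
    · exact Or.inr (hX.inj _ _ _ _ hij hrs.symm h).symm
    · exact Or.inl (hT i j hij h)
  have hc1 := hcyc r s hrs hnot
  have hc2 := hcyc s r hrs.symm fun h => hnot h.symm
  have hclause : (ResTree.resolve (X s r) (.leaf (insert (X s r) (cycleClause X a b c)))
      (.leaf (insert (X r s) (cycleClause X a b c)))).clause = cycleClause X a b c := by
    simp only [ResTree.resolve, ResTree.clause, hX.neg s r hrs.symm,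
      Finset.erase_insert hc1, Finset.erase_insert hc2, Finset.union_self]
  -- The guard is unset: both guarded clauses are leaves, so their resolvent is an input lemma.
  refine ⟨_, (hfalse r s hrs hs L).branch hX (hfalse s r hrs.symm hr _) hrs hrs' hsr
    (Finset.mem_insert_self _ _) (Finset.mem_insert_self _ _), ?_, hclause.ge, fun _ => ?_⟩
  · simp [ResTree.resolve, ResTree.size]
  · refine Or.inr ⟨hclause.symm, Or.inl trivial, trivial, trivial⟩

variable (X) in
open Classical in
/-- The number of transitivity clauses that are not yet lemmas. -/
noncomputable def numUnlearned (L : Set (Clause V)) : ℕ :=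
  (Finset.univ.filter fun p : Fin n × Fin n × Fin n => cycleClause X p.1 p.2.1 p.2.2 ∉ L).card

theorem numUnlearned_le (L : Set (Clause V)) : numUnlearned X L ≤ n ^ 3 := by
  refine (Finset.card_le_univ _).trans ?_
  simp only [Fintype.card_prod, Fintype.card_fin]
  exact (by ring : n * (n * n) = n ^ 3).le

theorem numUnlearned_anti {L L' : Set (Clause V)} (h : L ⊆ L') :
    numUnlearned X L' ≤ numUnlearned X L := by
  classical
  exact Finset.card_le_card fun p hp => by
    simp only [Finset.mem_filter] at hp ⊢
    exact ⟨hp.1, fun hL => hp.2 (h hL)⟩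

theorem numUnlearned_lt {L L' : Set (Clause V)} (h : L ⊆ L') {a b c : Fin n}
    (h1 : cycleClause X a b c ∉ L) (h2 : cycleClause X a b c ∈ L') :
    numUnlearned X L' < numUnlearned X L := by
  classical
  refine Finset.card_lt_card ⟨fun p hp => ?_, fun hsub => ?_⟩
  · simp only [Finset.mem_filter] at hp ⊢
    exact ⟨hp.1, fun hL => hp.2 (h hL)⟩
  · have := hsub (x := (a, b, c)) (by simpa using h1)
    simp only [Finset.mem_filter] at this
    exact this.2 h2

variable (X F) in
/-- `α` has a solution of size `m` plus `B` for each transitivity clause learned in it. -/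
def CanSolve (B : ℕ) (L : Set (Clause V)) (α : Fin n → Fin n → Prop) (m : ℕ) : Prop :=
  ∃ t, SolvesUnder X F L α t ∧
    t.size + B * numUnlearned X (L ∪ t.inputClauses) ≤ m + B * numUnlearned X L

theorem isSource_addArc {u v i : Fin n} (h : IsSource α i) (hi : i ≠ v) :
    IsSource (addArc α u v) i :=
  fun j hj => hj.elim (h j) fun h => hi h.2

theorem CanSolve.mono {B m m' : ℕ} (h : CanSolve X F B L α m) (hm : m ≤ m') :
    CanSolve X F B L α m' := by
  obtain ⟨t, ht, hs⟩ := h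
  exact ⟨t, ht, hs.trans (Nat.add_le_add_right hm _)⟩

/-- Add an arc that shortcuts a path of length two from a source. -/
theorem CanSolve.of_shortcut (hF : GuardedTautology X F) (hirr : ∀ i, ¬ α i i) {B m : ℕ}
    {p a j : Fin n} (hp : IsSource α p) (hpa : α p a) (haj : α a j) (hpj : ¬ α p j)
    (h : CanSolve X F B L (addArc α p j) m) : CanSolve X F B L α (m + 4) := by
  obtain ⟨s, hs, hsize⟩ := h
  have hne1 : p ≠ a := by rintro rfl; exact hirr _ hpa
  have hne2 : a ≠ j := by rintro rfl; exact hirr _ haj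
  have hne3 : p ≠ j := by rintro rfl; exact hp _ haj
  -- The reverse arc from `j` to `p` closes the triangle `p, a, j`, refuted by at most three nodes;
  -- the resolvent is the fourth.
  obtain ⟨t, ht, htsize, htc, -⟩ := hF.exists_refutesUnder (α := addArc α j p) (β := addArc α j p)
    (a := p) (b := a) (c := j) (fun i j h => Or.inl h) hne1 hne2 hne3.symm (Or.inl hpa)
    (Or.inl haj) (Or.inr ⟨rfl, rfl⟩) (L ∪ s.inputClauses)
  have hsrc : ∀ i, IsSource α i → IsSource (addArc α p j) i := fun i hi =>
    isSource_addArc hi (by rintro rfl; exact hi _ haj)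
  have hms : X j p ∈ s.clause := hs.out_mem p j (hsrc p hp) (Or.inr ⟨rfl, rfl⟩)
  refine ⟨_, ⟨hs.toRefutesUnder.branch hF.lits ht hne3 hpj (hp j) hms
    (htc (by simp [cycleClause])), ?_⟩, ?_⟩
  · intro i l hi hil
    refine (hF.lits.mem_resolve hne3.symm ?_ _ _).2 (Or.inl ⟨hs.out_mem i l (hsrc i hi)
      (Or.inl hil), ?_⟩)
    · rintro rfl; exact hirr _ hil
    · rintro ⟨rfl, rfl⟩
      exact hpj hil
  · have := Nat.mul_le_mul_left B (numUnlearned_anti (X := X) (Set.union_subset_union_right L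
      (ResTree.inputClauses_resolve_left (X j p) s t)))
    simp only [ResTree.resolve, ResTree.size] at this ⊢
    omega

open Classical in
/-- The number of non-sources without a source predecessor. -/
noncomputable def numUncovered (α : Fin n → Fin n → Prop) : ℕ :=
  (Finset.univ.filter fun j => ¬ (IsSource α j ∨ ∃ p, IsSource α p ∧ α p j)).card

/-- Each shortcut covers one more vertex. Its head already has a predecessor, so no source is lost
and no covered vertex becomes uncovered. -/
theorem CanSolve.of_isWeaklyCovered_aux (hF : GuardedTautology X F) {B m : ℕ}
    (H : ∀ β : Fin n → Fin n → Prop, (∀ i, ¬ β i i) → IsCovered β → CanSolve X F B L β m) :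
    ∀ (d : ℕ) (α : Fin n → Fin n → Prop), (∀ i, ¬ α i i) → IsWeaklyCovered α →
      numUncovered α ≤ d → CanSolve X F B L α (m + 4 * d) := by
  classical
  intro d
  induction d with
  | zero =>
    intro α hirr _ hd
    refine H α hirr fun j => ?_
    by_contra hj
    have := Finset.card_eq_zero.1 (Nat.le_zero.1 hd)
    exact Finset.notMem_empty j (this ▸ Finset.mem_filter.2 ⟨Finset.mem_univ _, hj⟩)
  | succ d ih =>
    intro α hirr hw hd
    by_cases hc : IsCovered α
    · exact (H α hirr hc).mono (Nat.le_add_right _ _)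
    simp only [IsCovered, not_forall] at hc
    obtain ⟨j, hj⟩ := hc
    obtain ⟨p, hp, hpj | ⟨a, hpa, haj⟩⟩ := (hw j).resolve_left fun h => hj (Or.inl h)
    · exact (hj (Or.inr ⟨p, hp, hpj⟩)).elim
    have hpj : ¬ α p j := fun h => hj (Or.inr ⟨p, hp, h⟩)
    have hne : p ≠ j := by rintro rfl; exact hp _ haj
    have hsrc : ∀ i, IsSource α i → IsSource (addArc α p j) i := fun i hi =>
      isSource_addArc hi (by rintro rfl; exact hi _ haj)
    have := ih (addArc α p j) ?_ ?_ ?_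
    · exact (this.of_shortcut hF hirr hp hpa haj hpj).mono (by omega)
    · rintro i (h | ⟨rfl, h⟩)
      · exact hirr i h
      · exact hne h
    · intro i
      refine (hw i).imp (hsrc i) ?_
      rintro ⟨q, hq, h⟩
      exact ⟨q, hsrc q hq, h.imp Or.inl fun ⟨a, h, h'⟩ => ⟨a, Or.inl h, Or.inl h'⟩⟩
    · refine Nat.lt_succ_iff.1 (lt_of_lt_of_le (Finset.card_lt_card ⟨fun i hi => ?_, fun h => ?_⟩)
        hd)
      · simp only [Finset.mem_filter] at hi ⊢
        exact ⟨hi.1, fun h => hi.2 (h.imp (hsrc i) fun ⟨q, hq, h⟩ => ⟨q, hsrc q hq, Or.inl h⟩)⟩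
      · have := h (Finset.mem_filter.2 ⟨Finset.mem_univ j, hj⟩)
        simp only [Finset.mem_filter] at this
        exact this.2 (Or.inr ⟨p, hsrc p hp, Or.inr ⟨rfl, rfl⟩⟩)

theorem CanSolve.of_isWeaklyCovered (hF : GuardedTautology X F) {B m : ℕ}
    (H : ∀ β : Fin n → Fin n → Prop, (∀ i, ¬ β i i) → IsCovered β → CanSolve X F B L β m)
    (hirr : ∀ i, ¬ α i i) (hα : IsWeaklyCovered α) : CanSolve X F B L α (m + 4 * n) :=
  of_isWeaklyCovered_aux hF H n α hirr hα ((Finset.card_le_univ _).trans (by simp))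

/-- A superset of a covered graph is weakly covered if its new non-sources are successors
of sources. -/
theorem IsCovered.isWeaklyCovered {β : Fin n → Fin n → Prop} (h : IsCovered α)
    (hsub : ∀ i j, α i j → β i j)
    (hnew : ∀ j, IsSource α j → IsSource β j ∨ ∃ p, IsSource β p ∧ β p j) :
    IsWeaklyCovered β := by
  intro j
  rcases h j with hj | ⟨p, hp, hpj⟩
  · exact (hnew j hj).imp id fun ⟨p, hp, h⟩ => ⟨p, hp, Or.inl h⟩
  · right
    rcases hnew p hp with hp' | ⟨q, hq, hqp⟩
    · exact ⟨p, hp', Or.inl (hsub _ _ hpj)⟩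
    · exact ⟨q, hq, Or.inr ⟨p, hqp, hsub _ _ hpj⟩⟩

end GGTRes

/-! ### Learning a missing transitivity clause -/

namespace GGTRes

variable {V : Type} [DecidableEq V] {n : ℕ} {X : Fin n → Fin n → Literal V}
  {F L : Set (Clause V)} {α : Fin n → Fin n → Prop}

theorem addArc_irrefl (hirr : ∀ i, ¬ α i i) {u v : Fin n} (h : u ≠ v) :
    ∀ i, ¬ addArc α u v i i := by
  rintro i (hi | ⟨rfl, hi⟩)
  · exact hirr i hi
  · exact h hi

/-- Learn the transitivity clause for `a, b, c`, where `a` precedes `b`. -/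
theorem exists_solvesUnder_of_arc (hF : GuardedTautology X F) (hirr : ∀ i, ¬ α i i) {B m : ℕ}
    {a b c : Fin n} (ha : IsSource α a) (hc : IsSource α c) (hac : a ≠ c) (hab : α a b)
    (hcb : ¬ α c b) (hav : ¬ IsAvailable X F L α a b c)
    (h : ∀ L', L ⊆ L' → numUnlearned X L' < numUnlearned X L →
      CanSolve X F B L' (addArc (addArc α b c) a c) m ∧ CanSolve X F B L' (addArc α c b) m) :
    ∃ t, SolvesUnder X F L α t ∧ numUnlearned X (L ∪ t.inputClauses) < numUnlearned X L ∧
      t.size + B * numUnlearned X (L ∪ t.inputClauses) + B ≤ 2 * m + 5 + B * numUnlearned X L := by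
  have hX := hF.lits
  have hne1 : a ≠ b := by rintro rfl; exact hirr _ hab
  have hne2 : b ≠ c := by rintro rfl; exact hc _ hab
  -- The new arcs both lie in the triangle, so availability can be measured in `β := α`. This branch
  -- comes first, so that its lemma is present in the other two.
  obtain ⟨t₁, ht₁, hs₁, hc₁, hi₁⟩ := hF.exists_refutesUnder
    (α := addArc (addArc α b c) c a) (β := α) (a := a) (b := b) (c := c)
    (by
      rintro i j ((h | ⟨rfl, rfl⟩) | ⟨rfl, rfl⟩)
      · exact Or.inl h
      · simp
      · simp) hne1 hne2 hac.symm (Or.inl (Or.inl hab)) (Or.inl (Or.inr ⟨rfl, rfl⟩))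
    (Or.inr ⟨rfl, rfl⟩) L
  have hlearn := hi₁ hav
  have hnot : cycleClause X a b c ∉ L := fun h =>
    hav ⟨_, Or.inr h, subset_rfl, fun _ _ _ h => Or.inl h⟩
  have hlt : numUnlearned X (L ∪ t₁.inputClauses) < numUnlearned X L :=
    numUnlearned_lt Set.subset_union_left hnot (Or.inr hlearn)
  obtain ⟨t₂, ht₂, hs₂⟩ := (h _ Set.subset_union_left hlt).1
  have hsrc₂ : ∀ i, IsSource α i → i ≠ c → IsSource (addArc (addArc α b c) a c) i :=
    fun i hi hic => isSource_addArc (isSource_addArc hi hic) hic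
  have hsrc₃ : ∀ i, IsSource α i → IsSource (addArc α c b) i :=
    fun i hi => isSource_addArc hi (by rintro rfl; exact hi _ hab)
  have hr := ht₁.branch hX ht₂.toRefutesUnder hac.symm
    (by rintro (h | h); exacts [ha _ h, hac h.2]) (by rintro (h | h); exacts [hc _ h, hne1 h.1])
    (hc₁ (by simp [cycleClause]))
    (ht₂.out_mem a c (hsrc₂ a ha hac) (Or.inr ⟨rfl, rfl⟩))
  have hsub₁ := ResTree.inputClauses_resolve_left (X a c) t₁ t₂
  have hsub₂ := ResTree.inputClauses_resolve_right (X a c) t₁ t₂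
  have hmem : ∀ i j, i ≠ j → X j i ∈ t₂.clause → ¬ (j = c ∧ i = a) →
      X j i ∈ (ResTree.resolve (X a c) t₁ t₂).clause := fun i j hij h hne =>
    (hX.mem_resolve hac hij.symm _ _).2 (Or.inr ⟨h, hne⟩)
  have hcb' : X c b ∈ (ResTree.resolve (X a c) t₁ t₂).clause :=
    (hX.mem_resolve hac hne2.symm _ _).2 (Or.inl ⟨hc₁ (by simp [cycleClause]),
      fun h => hac h.1.symm⟩)
  generalize hr₀ : ResTree.resolve (X a c) t₁ t₂ = r at hr hsub₁ hsub₂ hmem hcb'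
  have hu₁ := numUnlearned_anti (X := X) (Set.union_subset_union_right L hsub₁)
  have hu₂ := numUnlearned_anti (X := X) (L := L ∪ t₁.inputClauses ∪ t₂.inputClauses)
    (L' := L ∪ r.inputClauses) (Set.union_subset (Set.union_subset Set.subset_union_left
      (hsub₁.trans Set.subset_union_right)) (hsub₂.trans Set.subset_union_right))
  obtain ⟨t₃, ht₃, hs₃⟩ := (h (L ∪ r.inputClauses) Set.subset_union_left (hu₁.trans_lt hlt)).2
  have hR := hr.branch hX ht₃.toRefutesUnder hne2 (hc b) hcb hcb'
    (ht₃.out_mem c b (hsrc₃ c hc) (Or.inr ⟨rfl, rfl⟩))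
  have hsub₃ := ResTree.inputClauses_resolve_left (X c b) r t₃
  have hsub₄ := ResTree.inputClauses_resolve_right (X c b) r t₃
  have hu₃ := numUnlearned_anti (X := X) (L := L ∪ r.inputClauses ∪ t₃.inputClauses)
    (L' := L ∪ (ResTree.resolve (X c b) r t₃).inputClauses)
    (Set.union_subset (Set.union_subset Set.subset_union_left
      (hsub₃.trans Set.subset_union_right)) (hsub₄.trans Set.subset_union_right))
  have hu₄ := numUnlearned_anti (X := X) (Set.union_subset_union_left t₃.inputClauses
    (Set.subset_union_left (s := L ∪ r.inputClauses) (t := ∅)))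
  have hu₅ := numUnlearned_anti (X := X)
    (Set.subset_union_left (s := L ∪ r.inputClauses) (t := t₃.inputClauses))
  refine ⟨_, ⟨hR, fun i j hi hij => ?_⟩, by omega, ?_⟩
  · have hne : i ≠ j := by rintro rfl; exact hirr _ hij
    refine (hX.mem_resolve hne2.symm hne.symm _ _).2 ?_
    -- In the branch of `t₂` the vertex `c` is no longer a source; the literals of its arcs come
    -- from `t₃`.
    by_cases hic : i = c
    · subst hic
      exact Or.inr ⟨ht₃.out_mem i j (hsrc₃ i hi) (Or.inl hij), by
        rintro ⟨rfl, -⟩; exact hcb hij⟩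
    · refine Or.inl ⟨hmem i j hne (ht₂.out_mem i j (hsrc₂ i hi hic) (Or.inl (Or.inl hij))) ?_, ?_⟩
      · rintro ⟨rfl, rfl⟩
        exact hc _ hij
      · rintro ⟨rfl, rfl⟩
        exact hi _ hab
  · have e : (ResTree.resolve (X c b) r t₃).size = t₁.size + t₂.size + t₃.size + 2 := by
      rw [← hr₀]
      simp only [ResTree.resolve, ResTree.size]
      omega
    have m₁ := Nat.mul_le_mul_left B hu₂
    have m₂ := Nat.mul_le_mul_left B hu₃
    have m₃ := Nat.mul_le_mul_left B (Nat.succ_le_of_lt hlt)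
    rw [Nat.succ_eq_add_one, Nat.mul_add, Nat.mul_one] at m₃
    omega

/-- Learn the transitivity clause for three sources. -/
theorem exists_solvesUnder_of_sources (hF : GuardedTautology X F) (hirr : ∀ i, ¬ α i i) {B m : ℕ}
    {a b c : Fin n} (ha : IsSource α a) (hb : IsSource α b) (hc : IsSource α c) (hab : a ≠ b)
    (hbc : b ≠ c) (hac : a ≠ c) (hav : ¬ IsAvailable X F L α a b c)
    (h : ∀ L', L ⊆ L' → numUnlearned X L' < numUnlearned X L →
      CanSolve X F B L' (addArc (addArc (addArc α a b) b c) a c) m ∧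
      CanSolve X F B L' (addArc (addArc α a b) c b) m ∧ CanSolve X F B L' (addArc α b a) m) :
    CanSolve X F B L α (3 * m + 6 - B) := by
  have hX := hF.lits
  obtain ⟨s, hs, hlt, hsize⟩ := exists_solvesUnder_of_arc (α := addArc α a b) (L := L) hF
    (addArc_irrefl hirr hab) (isSource_addArc ha hab) (isSource_addArc hc hbc.symm) hac
    (Or.inr ⟨rfl, rfl⟩) (by rintro (h | h); exacts [hb _ h, hac h.1.symm])
    -- The arc from `a` to `b` falsifies only `X b a`, which belongs to the cycle clause, so it does
    -- not make the clause available.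
    (fun ⟨D, hD, hsub, hfal⟩ => hav ⟨D, hD, hsub, fun u v huv hm => by
      rcases hfal u v huv hm with h | h | ⟨rfl, rfl⟩
      · exact Or.inl h
      · exact Or.inr h
      · exact Or.inl (by simp [cycleClause])⟩)
    (fun L' hL hu => ⟨(h L' hL hu).1, (h L' hL hu).2.1⟩)
  obtain ⟨t, ht, htsize⟩ := (h _ Set.subset_union_left hlt).2.2
  have hR := hs.branch hX ht.toRefutesUnder hab (hb a) (ha b)
    (hs.out_mem a b (isSource_addArc ha hab) (Or.inr ⟨rfl, rfl⟩))
    (ht.out_mem b a (isSource_addArc hb hab.symm) (Or.inr ⟨rfl, rfl⟩))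
  have hsub₁ := ResTree.inputClauses_resolve_left (X b a) s t
  have hsub₂ := ResTree.inputClauses_resolve_right (X b a) s t
  have hu := numUnlearned_anti (X := X) (L := L ∪ s.inputClauses ∪ t.inputClauses)
    (L' := L ∪ (ResTree.resolve (X b a) s t).inputClauses)
    (Set.union_subset (Set.union_subset Set.subset_union_left
      (hsub₁.trans Set.subset_union_right)) (hsub₂.trans Set.subset_union_right))
  refine ⟨_, ⟨hR, fun i j hi hij => ?_⟩, ?_⟩
  · have hne : i ≠ j := by rintro rfl; exact hirr _ hij
    refine (hX.mem_resolve hab.symm hne.symm _ _).2 ?_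
    by_cases hib : i = b
    · subst hib
      exact Or.inr ⟨ht.out_mem i j (isSource_addArc hi hab.symm) (Or.inl hij), by
        rintro ⟨rfl, -⟩; exact ha _ hij⟩
    · exact Or.inl ⟨hs.out_mem i j (isSource_addArc hi hib) (Or.inl hij), by
        rintro ⟨rfl, rfl⟩; exact hb _ hij⟩
  · have m₁ := Nat.mul_le_mul_left B hu
    simp only [ResTree.resolve, ResTree.size] at m₁ ⊢
    omega

/-- If all partial tournaments that need no new transitivity clause can be solved in size `A`, then
all partial tournaments can be solved. -/
theorem canSolve_of_forall_available (hF : GuardedTautology X F) {A B : ℕ}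
    (hB : 2 * A + 12 * n + 6 ≤ B)
    (H : ∀ (L : Set (Clause V)) (α : Fin n → Fin n → Prop), (∀ i, ¬ α i i) → IsCovered α →
      (∀ a b c, IsSource α a → IsSource α b → IsSource α c → a ≠ b → b ≠ c → a ≠ c →
        IsAvailable X F L α a b c) →
      (∀ a b c, IsSource α a → IsSource α c → a ≠ c → α a b → ¬ α c b →
        IsAvailable X F L α a b c) →
      ∃ t, SolvesUnder X F L α t ∧ t.size ≤ A) :
    ∀ (u : ℕ) (L : Set (Clause V)) (α : Fin n → Fin n → Prop), numUnlearned X L ≤ u →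
      (∀ i, ¬ α i i) → IsCovered α → CanSolve X F B L α A := by
  intro u
  induction u using Nat.strong_induction_on with
  | _ u ih =>
    intro L α hu hirr hcov
    -- A learned clause lowers the induction parameter; the additional `4 * n` pays for the
    -- shortcuts that turn weak coverage into coverage.
    have hrec : ∀ L', numUnlearned X L' < numUnlearned X L → ∀ β : Fin n → Fin n → Prop,
        (∀ i, ¬ β i i) → IsWeaklyCovered β → CanSolve X F B L' β (A + 4 * n) :=
      fun L' hL' β hβ hw => .of_isWeaklyCovered hF
        (fun γ hγ hc => ih _ (hL'.trans_le hu) L' γ le_rfl hγ hc) hβ hw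
    by_cases h1 : ∀ a b c, IsSource α a → IsSource α b → IsSource α c → a ≠ b → b ≠ c → a ≠ c →
        IsAvailable X F L α a b c
    · by_cases h2 : ∀ a b c, IsSource α a → IsSource α c → a ≠ c → α a b → ¬ α c b →
          IsAvailable X F L α a b c
      · obtain ⟨t, ht, hs⟩ := H L α hirr hcov h1 h2
        exact ⟨t, ht, Nat.add_le_add hs
          (Nat.mul_le_mul_left B (numUnlearned_anti Set.subset_union_left))⟩
      · push Not at h2
        obtain ⟨a, b, c, ha, hc, hac, hab, hcb, hav⟩ := h2
        have hne1 : a ≠ b := by rintro rfl; exact hirr _ hab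
        have hne2 : b ≠ c := by rintro rfl; exact hc _ hab
        have hw : IsWeaklyCovered (addArc (addArc α b c) a c) := by
          refine hcov.isWeaklyCovered (fun i j h => Or.inl (Or.inl h)) fun j hj => ?_
          by_cases hjc : j = c
          · exact Or.inr ⟨a, isSource_addArc (isSource_addArc ha hac) hac, Or.inr ⟨rfl, hjc⟩⟩
          · exact Or.inl (isSource_addArc (isSource_addArc hj hjc) hjc)
        have hw' : IsWeaklyCovered (addArc α c b) :=
          hcov.isWeaklyCovered (fun i j h => Or.inl h) fun j hj =>
            Or.inl (isSource_addArc hj (by rintro rfl; exact hj _ hab))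
        obtain ⟨t, ht, -, hs⟩ := exists_solvesUnder_of_arc hF hirr (B := B) ha hc hac hab hcb hav
          fun L' _ hL' => ⟨hrec L' hL' _ (addArc_irrefl (addArc_irrefl hirr hne2) hac) hw,
            hrec L' hL' _ (addArc_irrefl hirr hne2.symm) hw'⟩
        exact ⟨t, ht, by omega⟩
    · push Not at h1
      obtain ⟨a, b, c, ha, hb, hc, hab, hbc, hac, hav⟩ := h1
      -- The bound `hB` is exactly `3 * (A + 4 * n) + 6 ≤ A + B`.
      refine (exists_solvesUnder_of_sources hF hirr (B := B) ha hb hc hab hbc hac hav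
          fun L' _ hL' => ⟨hrec L' hL' _ (addArc_irrefl (addArc_irrefl (addArc_irrefl hirr hab) hbc)
            hac) ?_, hrec L' hL' _ (addArc_irrefl (addArc_irrefl hirr hab) hbc.symm) ?_,
            hrec L' hL' _ (addArc_irrefl hirr hab.symm) ?_⟩).mono (by omega)
      · refine hcov.isWeaklyCovered (fun i j h => Or.inl (Or.inl (Or.inl h))) fun j hj => ?_
        have ha' := isSource_addArc (u := a) (isSource_addArc (u := b)
          (isSource_addArc (u := a) ha hab) hac) hac
        by_cases hjc : j = c
        · exact Or.inr ⟨a, ha', Or.inr ⟨rfl, hjc⟩⟩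
        by_cases hjb : j = b
        · exact Or.inr ⟨a, ha', Or.inl (Or.inl (Or.inr ⟨rfl, hjb⟩))⟩
        · exact Or.inl (isSource_addArc (isSource_addArc (isSource_addArc hj hjb) hjc) hjc)
      · refine hcov.isWeaklyCovered (fun i j h => Or.inl (Or.inl h)) fun j hj => ?_
        by_cases hjb : j = b
        · exact Or.inr ⟨a, isSource_addArc (isSource_addArc ha hab) hab,
            Or.inl (Or.inr ⟨rfl, hjb⟩)⟩
        · exact Or.inl (isSource_addArc (isSource_addArc hj hjb) hjb)
      · refine hcov.isWeaklyCovered (fun i j h => Or.inl h) fun j hj => ?_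
        by_cases hja : j = a
        · exact Or.inr ⟨b, isSource_addArc hb hab.symm, Or.inr ⟨rfl, hja⟩⟩
        · exact Or.inl (isSource_addArc hj hja)

end GGTRes

/-! ### Elimination of sources when the transitivity clauses are available -/

namespace GGTRes

variable {V : Type} {n : ℕ} {X : Fin n → Fin n → Literal V}
  {F L : Set (Clause V)} {α : Fin n → Fin n → Prop}

variable (X) in
/-- `C` says that some source below `k` precedes the vertex `i`, up to literals falsified by `α`,
among them those belonging to arcs out of `i` and out of the sources from `k` on. -/
structure IsLayerClause (α : Fin n → Fin n → Prop) (k : ℕ) (i : Fin n) (C : Clause V) : Prop where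
  sub : ∀ u v, u ≠ v → X u v ∈ C → α v u ∨ (v = i ∧ IsSource α u ∧ (u : ℕ) < k)
  mem : ∀ u, IsSource α u → u ≠ i → (u : ℕ) < k → X u i ∈ C
  out : ∀ v l, IsSource α v → (v = i ∨ k ≤ v) → α v l → X l v ∈ C

variable (X) in
/-- A clause for `k` and `i` is available. -/
def HasLayer (F L : Set (Clause V)) (α : Fin n → Fin n → Prop) (k : ℕ) (i : Fin n) : Prop :=
  ∃ C, (C ∈ F ∨ C ∈ L) ∧ IsLayerClause X α k i C

variable (X) in
open Classical in
/-- The number of layers that are not yet available. -/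
noncomputable def numLayers (F L : Set (Clause V)) (α : Fin n → Fin n → Prop) : ℕ :=
  (Finset.univ.filter fun p : Fin (n + 1) × Fin n => ¬ HasLayer X F L α p.1 p.2).card

theorem HasLayer.mono {L' : Set (Clause V)} {k : ℕ} {i : Fin n} (h : HasLayer X F L α k i)
    (hL : L ⊆ L') : HasLayer X F L' α k i := by
  obtain ⟨C, hC, h⟩ := h
  exact ⟨C, hC.imp id (@hL _), h⟩

theorem numLayers_le : numLayers X F L α ≤ (n + 1) * n :=
  (Finset.card_le_univ _).trans (by simp)

theorem numLayers_anti {L' : Set (Clause V)} (hL : L ⊆ L') :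
    numLayers X F L' α ≤ numLayers X F L α := by
  classical
  exact Finset.card_le_card fun p hp => by
    simp only [Finset.mem_filter] at hp ⊢
    exact ⟨hp.1, fun h => hp.2 (h.mono hL)⟩

theorem numLayers_lt {L' : Set (Clause V)} (hL : L ⊆ L') {k : ℕ} (hk : k ≤ n) {i : Fin n}
    (h : ¬ HasLayer X F L α k i) (h' : HasLayer X F L' α k i) :
    numLayers X F L' α < numLayers X F L α := by
  classical
  refine Finset.card_lt_card ⟨fun p hp => ?_, fun hsub => ?_⟩
  · simp only [Finset.mem_filter] at hp ⊢
    exact ⟨hp.1, fun h => hp.2 (h.mono hL)⟩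
  · have := hsub (x := (⟨k, Nat.lt_succ_of_le hk⟩, i)) (by simpa using h)
    simp only [Finset.mem_filter] at this
    exact this.2 h'

variable [DecidableEq V]

/-- Resolve successively on the literals `X j v`, `j ∈ J`, with leaves; the literals that these
introduce lie in `Q`. -/
theorem OrderLiterals.exists_chain (hX : OrderLiterals X) {t₀ : ResTree V}
    (h₀ : t₀.IsDerivation F L) {v : Fin n} {Q : Fin n → Fin n → Prop} (J : Finset (Fin n))
    (hv : ∀ j ∈ J, j ≠ v) (hmem : ∀ j ∈ J, X j v ∈ t₀.clause)
    (hnot : ∀ j ∈ J, X v j ∉ t₀.clause) (hvar : ∀ j ∈ J, (X j v).1 ∉ t₀.resolvedVars)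
    (hleaf : ∀ j ∈ J, ∃ D, (D ∈ F ∨ D ∈ L) ∧ X v j ∈ D ∧
      ∀ c d, c ≠ d → X c d ∈ D → (c = v ∧ d = j) ∨ Q c d)
    (hQ : ∀ j ∈ J, ¬ Q j v ∧ ¬ Q v j) :
    ∃ t : ResTree V, t.IsDerivation F L ∧ t.size ≤ t₀.size + 2 * J.card ∧
      (t₀.IsInput → t.IsInput) ∧ t₀.inputClauses ⊆ t.inputClauses ∧
      (∀ c d, c ≠ d → X c d ∈ t.clause → (X c d ∈ t₀.clause ∧ ¬ (d = v ∧ c ∈ J)) ∨ Q c d) ∧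
      (∀ c d, c ≠ d → X c d ∈ t₀.clause → ¬ (d = v ∧ c ∈ J) → X c d ∈ t.clause) ∧
      (∀ c d, c ≠ d → (X c d).1 ∈ t.resolvedVars →
        (X c d).1 ∈ t₀.resolvedVars ∨ (c ∈ J ∧ d = v) ∨ (d ∈ J ∧ c = v)) := by
  induction J using Finset.induction_on with
  | empty =>
    refine ⟨t₀, h₀, by simp, id, subset_rfl, fun c d _ h => Or.inl ⟨h, ?_⟩, fun _ _ _ h _ => h,
      fun _ _ _ h => Or.inl h⟩
    rintro ⟨-, h⟩
    exact Finset.notMem_empty _ h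
  | insert j J hj ih =>
    have hs : ∀ i ∈ J, i ∈ insert j J := fun i hi => Finset.mem_insert_of_mem hi
    have hjj := Finset.mem_insert_self j J
    obtain ⟨t, ht, hsize, hin, hsub, h1, h2, h3⟩ := ih (fun i hi => hv i (hs i hi))
      (fun i hi => hmem i (hs i hi)) (fun i hi => hnot i (hs i hi)) (fun i hi => hvar i (hs i hi))
      (fun i hi => hleaf i (hs i hi)) (fun i hi => hQ i (hs i hi))
    -- By `hQ`, the side literals in `Q` are never `X j v` or `X v j` with `j ∈ J`, so no leaf
    -- spoils a resolution of the chain.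
    obtain ⟨D, hD, hvD, hDQ⟩ := hleaf j hjj
    have hjv := hv j hjj
    have hneg := hX.neg j v hjv
    have hdd : ∀ c d, c ≠ d → X c d ∈ D → ¬ (c = v ∧ d = j) → Q c d :=
      fun c d hcd h hne => (hDQ c d hcd h).resolve_left hne
    refine ⟨.resolve (X j v) t (.leaf D), ht.resolve (.of_mem (hD.imp id Or.inl)) ?_ ?_ ?_ ?_ ?_ ?_,
      ?_, fun h => ⟨Or.inr trivial, hin h, trivial⟩,
      hsub.trans (ResTree.inputClauses_resolve_left _ _ _), fun c d hcd h => ?_,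
      fun c d hcd h hne => ?_, fun c d hcd h => ?_⟩
    · exact h2 j v hjv (hmem j hjj) fun h => hj h.2
    · rw [hneg]
      intro h
      rcases h1 v j hjv.symm h with h | h
      · exact hnot j hjj h.1
      · exact (hQ j hjj).2 h
    · rwa [hneg]
    · exact fun h => (hQ j hjj).1 (hdd j v hjv h fun h => hjv h.1)
    · intro h
      rcases h3 j v hjv h with h | h | h
      · exact hvar j hjj h
      · exact hj h.1
      · exact hjv h.2
    · exact fun h => h
    · rw [Finset.card_insert_of_notMem hj]
      simp only [ResTree.resolve, ResTree.size]
      omega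
    · rcases (hX.mem_resolve hjv hcd _ _).1 h with ⟨h, hne⟩ | ⟨h, hne⟩
      · refine (h1 c d hcd h).imp (fun h => ⟨h.1, fun hd => ?_⟩) id
        rcases Finset.mem_insert.1 hd.2 with hc | hc
        · exact hne ⟨hc, hd.1⟩
        · exact h.2 ⟨hd.1, hc⟩
      · exact Or.inr (hdd c d hcd h hne)
    · refine (hX.mem_resolve hjv hcd _ _).2 (Or.inl ⟨h2 c d hcd h fun hd => hne ⟨hd.1, hs _ hd.2⟩,
        fun hd => hne ⟨hd.2, hd.1 ▸ hjj⟩⟩)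
    · rcases h with h | h | h
      · rcases hX.fst_eq hcd hjv h with ⟨rfl, rfl⟩ | ⟨rfl, rfl⟩
        · exact Or.inr (Or.inl ⟨hjj, rfl⟩)
        · exact Or.inr (Or.inr ⟨hjj, rfl⟩)
      · exact (h3 c d hcd h).imp id (Or.imp (And.imp (hs c) id) (And.imp (hs d) id))
      · exact h.elim

variable (X) in
/-- The transitivity clauses needed for the elimination of sources are available. -/
structure IsReady (F L : Set (Clause V)) (α : Fin n → Fin n → Prop) : Prop where
  irrefl : ∀ i, ¬ α i i
  covered : IsCovered α
  sources : ∀ a b c, IsSource α a → IsSource α b → IsSource α c → a ≠ b → b ≠ c → a ≠ c →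
    IsAvailable X F L α a b c
  arc : ∀ a b c, IsSource α a → IsSource α c → a ≠ c → α a b → ¬ α c b → IsAvailable X F L α a b c

theorem IsReady.mono {L' : Set (Clause V)} (h : IsReady X F L α) (hL : L ⊆ L') :
    IsReady X F L' α :=
  ⟨h.irrefl, h.covered, fun a b c ha hb hc h1 h2 h3 => (h.sources a b c ha hb hc h1 h2 h3).mono hL,
    fun a b c ha hc h1 h2 h3 => (h.arc a b c ha hc h1 h2 h3).mono hL⟩

variable (X) in
/-- `t` derives a clause for `k` and `i`, resolving only on variables not set by `α` that
do not relate two sources below `k`. Unless it is a leaf, it makes a new layer available. -/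
structure DerivesLayer (F L : Set (Clause V)) (α : Fin n → Fin n → Prop) (k : ℕ) (i : Fin n)
    (t : ResTree V) : Prop extends t.IsDerivation F L where
  layer : IsLayerClause X α k i t.clause
  resolved : ∀ c d, c ≠ d → (X c d).1 ∈ t.resolvedVars →
    ¬ α c d ∧ ¬ α d c ∧ (IsSource α c → IsSource α d → k ≤ c ∨ k ≤ d)
  progress : t.IsLeaf ∨ numLayers X F (L ∪ t.inputClauses) α < numLayers X F L α

theorem HasLayer.exists_derivesLayer {k : ℕ} {i : Fin n} (h : HasLayer X F L α k i) :
    ∃ t, DerivesLayer X F L α k i t ∧ t.size = 1 := by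
  obtain ⟨C, hC, h⟩ := h
  exact ⟨.leaf C, ⟨.of_mem hC, h, fun _ _ _ h => h.elim, Or.inl trivial⟩, rfl⟩

/-- The clause for `n` and `i` is derived from the clause stating that `i` is not minimal. -/
theorem GuardedTautology.exists_derivesLayer_last (hF : GuardedTautology X F)
    (hr : IsReady X F L α) {i : Fin n} (hi : IsSource α i) (hn : ¬ HasLayer X F L α n i) :
    ∃ t, DerivesLayer X F L α n i t ∧ t.size ≤ 1 + 2 * n := by
  classical
  have hX := hF.lits
  obtain ⟨C, hC, hCi⟩ := hF.notMinimal i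
  -- For such a `j` coverage gives a source `p` preceding it. The clause for `p, j, i` trades `X j
  -- i` for `X p i`, and its third literal `X j p` is falsified by `α`.
  let J : Finset (Fin n) := Finset.univ.filter fun j => ¬ IsSource α j ∧ ¬ α i j
  have hJ : ∀ j, j ∈ J ↔ ¬ IsSource α j ∧ ¬ α i j := fun j => by simp [J]
  have hJi : ∀ j ∈ J, j ≠ i := by
    rintro j hj rfl
    exact ((hJ j).1 hj).1 hi
  obtain ⟨t, ht, hsize, hin, -, h1, h2, h3⟩ := hX.exists_chain (L := L)
    (t₀ := .leaf C) (.of_mem (Or.inl hC)) (v := i)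
    (Q := fun c d => α d c ∨ (d = i ∧ IsSource α c)) J hJi
    (fun j hj => (hCi j i (hJi j hj)).2 rfl)
    (fun j hj h => hJi j hj ((hCi i j (hJi j hj).symm).1 h)) (fun _ _ h => h)
    (fun j hj => by
      obtain ⟨hj1, hj2⟩ := (hJ j).1 hj
      obtain ⟨p, hp, hpj⟩ := (hr.covered j).resolve_left hj1
      have hpi : p ≠ i := by rintro rfl; exact hj2 hpj
      have hpj' : p ≠ j := by rintro rfl; exact hr.irrefl _ hpj
      obtain ⟨D, hD, hsub, hfal⟩ := hr.arc p j i hp hi hpi hpj hj2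
      refine ⟨D, hD, hsub (by simp [cycleClause]), fun c d hcd h => ?_⟩
      rcases hfal c d hcd h with h | h
      · rcases (hX.mem_cycleClause hpj' (hJi j hj) hpi.symm hcd).1 h with
          ⟨rfl, rfl⟩ | h | ⟨rfl, rfl⟩
        · exact Or.inr (Or.inl hpj)
        · exact Or.inl h
        · exact Or.inr (Or.inr ⟨rfl, hp⟩)
      · exact Or.inr (Or.inl h))
    (fun j hj => by
      obtain ⟨hj1, hj2⟩ := (hJ j).1 hj
      exact ⟨fun h => h.elim hj2 fun h => hj1 h.2,
        fun h => h.elim (hi j) fun h => hJi j hj h.1⟩)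
  have hlayer : IsLayerClause X α n i t.clause := by
    refine ⟨fun u v huv h => ?_, fun u hu hui _ => ?_, fun v l hv hvi hvl => ?_⟩
    · rcases h1 u v huv h with ⟨h, hne⟩ | h | h
      · have hv := (hCi u v huv).1 h
        subst hv
        by_cases hu : IsSource α u
        · exact Or.inr ⟨rfl, hu, u.2⟩
        · left
          by_contra hα
          exact hne ⟨rfl, (hJ u).2 ⟨hu, hα⟩⟩
      · exact Or.inl h
      · exact Or.inr ⟨h.1, h.2, u.2⟩
    · exact h2 u i hui ((hCi u i hui).2 rfl) fun h => ((hJ u).1 h.2).1 hu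
    · obtain rfl := hvi.resolve_right (by have := v.2; omega)
      have hlv : l ≠ v := by rintro rfl; exact hr.irrefl _ hvl
      exact h2 l v hlv ((hCi l v hlv).2 rfl) fun h => ((hJ l).1 h.2).2 hvl
  refine ⟨t, ⟨ht, hlayer, fun c d hcd h => ?_, ?_⟩, ?_⟩
  · rcases h3 c d hcd h with h | ⟨h, rfl⟩ | ⟨h, rfl⟩
    · exact h.elim
    · exact ⟨hi c, ((hJ c).1 h).2, fun hc => (((hJ c).1 h).1 hc).elim⟩
    · exact ⟨((hJ d).1 h).2, hi d, fun _ hd => (((hJ d).1 h).1 hd).elim⟩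
  · by_cases hl : t.IsLeaf
    · exact Or.inl hl
    · exact Or.inr (numLayers_lt Set.subset_union_left le_rfl hn
        ⟨_, Or.inr (Or.inr ((hin trivial).clause_mem hl)), hlayer⟩)
  · refine hsize.trans ?_
    have := Finset.card_le_univ J
    simp only [Fintype.card_fin] at this
    simp only [ResTree.size]
    omega

/-- Eliminate the source `k`. -/
theorem GuardedTautology.exists_derivesLayer_step (hF : GuardedTautology X F)
    (hr : IsReady X F L α) {k i : Fin n} (hk : IsSource α k) (hi : IsSource α i) (hik : i < k)
    (hn : ¬ HasLayer X F L α k i) {s t : ResTree V} (hs : DerivesLayer X F L α (k + 1) i s)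
    (ht : DerivesLayer X F (L ∪ s.inputClauses) α (k + 1) k t) :
    ∃ r, DerivesLayer X F L α k i r ∧ r.size ≤ s.size + t.size + 2 * n + 1 ∧
      L ∪ s.inputClauses ∪ t.inputClauses ⊆ L ∪ r.inputClauses := by
  classical
  have hX := hF.lits
  -- For `j ∈ J` the clause for `j, k, i` trades `X j k` for `X j i` and `X i k`. The source `i` is
  -- left out because `X i k` is needed in the final resolution on `X k i`.
  let J : Finset (Fin n) := Finset.univ.filter fun j => IsSource α j ∧ j < k ∧ j ≠ i
  have hJ : ∀ j, j ∈ J ↔ IsSource α j ∧ j < k ∧ j ≠ i := fun j => by simp [J]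
  have hr' := hr.mono (Set.subset_union_left (t := s.inputClauses))
  obtain ⟨q, hq, hsize, hin, hsub, h1, h2, h3⟩ := hX.exists_chain ht.toIsDerivation (v := k)
    (Q := fun c d => α d c ∨ (c = i ∧ d = k) ∨ (d = i ∧ IsSource α c ∧ c < k)) J
    (fun j hj => ((hJ j).1 hj).2.1.ne)
    (fun j hj => ht.layer.mem j ((hJ j).1 hj).1 ((hJ j).1 hj).2.1.ne
      (Nat.lt_succ_of_lt ((hJ j).1 hj).2.1))
    (fun j hj h => by
      rcases ht.layer.sub k j ((hJ j).1 hj).2.1.ne' h with h | h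
      · exact hk _ h
      · exact ((hJ j).1 hj).2.1.ne h.1)
    -- Regularity: derivations for `k + 1` do not resolve on variables relating two sources below `k
    -- + 1`.
    (fun j hj h => by
      have hlt : (j : ℕ) < k := ((hJ j).1 hj).2.1
      have := (ht.resolved j k ((hJ j).1 hj).2.1.ne h).2.2 ((hJ j).1 hj).1 hk
      omega)
    (fun j hj => by
      obtain ⟨hj1, hj2, hj3⟩ := (hJ j).1 hj
      obtain ⟨D, hD, hsub, hfal⟩ := hr'.sources j k i hj1 hk hi hj2.ne hik.ne' hj3
      refine ⟨D, hD, hsub (by simp [cycleClause]), fun c d hcd h => ?_⟩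
      rcases hfal c d hcd h with h | h
      · rcases (hX.mem_cycleClause hj2.ne hik.ne' hj3.symm hcd).1 h with h | h | ⟨rfl, rfl⟩
        · exact Or.inl h
        · exact Or.inr (Or.inr (Or.inl h))
        · exact Or.inr (Or.inr (Or.inr ⟨rfl, hj1, hj2⟩))
      · exact Or.inr (Or.inl h))
    (fun j hj => by
      obtain ⟨hj1, hj2, hj3⟩ := (hJ j).1 hj
      refine ⟨?_, ?_⟩
      · rintro (h | h | h)
        exacts [hj1 _ h, hj3 h.1, hik.ne' h.1]
      · rintro (h | h | h)
        exacts [hk _ h, hik.ne' h.1, hj3 h.1])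
  have hqsub : ∀ c d, c ≠ d → X c d ∈ q.clause →
      α d c ∨ (c = i ∧ d = k) ∨ (d = i ∧ IsSource α c ∧ c < k) := by
    intro c d hcd h
    rcases h1 c d hcd h with ⟨h, hne⟩ | h
    · rcases ht.layer.sub c d hcd h with h | ⟨rfl, h, hlt⟩
      · exact Or.inl h
      · by_cases hci : c = i
        · exact Or.inr (Or.inl ⟨hci, rfl⟩)
        · exact (hne ⟨rfl, (hJ c).2 ⟨h, lt_of_le_of_ne (Nat.lt_succ_iff.1 hlt) hcd, hci⟩⟩).elim
    · exact h
  have hki := hik.ne'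
  have hneg := hX.neg k i hki
  have hiJ : i ∉ J := fun h => ((hJ i).1 h).2.2 rfl
  have hd : (ResTree.resolve (X k i) s q).IsDerivation F L := by
    refine hs.toIsDerivation.resolve hq ?_ ?_ ?_ ?_ ?_ ?_
    · exact hs.layer.mem k hk hki (Nat.lt_succ_self _)
    · rw [hneg]
      intro h
      rcases hs.layer.sub i k hik.ne h with h | h
      exacts [hi _ h, hki h.1]
    · rw [hneg]
      exact h2 i k hik.ne (ht.layer.mem i hi hik.ne (Nat.lt_succ_of_lt hik)) fun h => hiJ h.2
    · intro h
      rcases hqsub k i hki h with h | h | h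
      exacts [hk _ h, hki h.1, lt_irrefl _ h.2.2]
    · intro h
      have := (hs.resolved k i hki h).2.2 hk hi
      have hlt : (i : ℕ) < k := hik
      omega
    · intro h
      rcases h3 k i hki h with h | h | h
      · have := (ht.resolved k i hki h).2.2 hk hi
        have hlt : (i : ℕ) < k := hik
        omega
      · exact hki h.2.symm
      · exact hiJ h.1
  have hlayer : IsLayerClause X α k i (ResTree.resolve (X k i) s q).clause := by
    refine ⟨fun u v huv h => ?_, fun u hu hui huk => ?_, fun v l hv hvi hvl => ?_⟩
    · rcases (hX.mem_resolve hki huv _ _).1 h with ⟨h, hne⟩ | ⟨h, hne⟩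
      · refine (hs.layer.sub u v huv h).imp id fun ⟨h1, h2, h3⟩ => ⟨h1, h2, ?_⟩
        refine lt_of_le_of_ne (Nat.lt_succ_iff.1 h3) fun h => hne ⟨Fin.ext h, h1⟩
      · rcases hqsub u v huv h with h | h | h
        · exact Or.inl h
        · exact (hne h).elim
        · exact Or.inr h
    · refine (hX.mem_resolve hki hui _ _).2 (Or.inl ⟨hs.layer.mem u hu hui (Nat.lt_succ_of_lt huk),
        ?_⟩)
      rintro ⟨rfl, -⟩
      exact lt_irrefl _ huk
    · have hlv : l ≠ v := by rintro rfl; exact hr.irrefl _ hvl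
      refine (hX.mem_resolve hki hlv _ _).2 ?_
      -- Arcs out of `k` are recorded in the clause for `k`, arcs out of `i` and of later sources in
      -- the clause for `i`.
      by_cases hvk : v = k
      · subst hvk
        refine Or.inr ⟨h2 l v hlv (ht.layer.out v l hv (Or.inl rfl) hvl) fun h =>
          ((hJ l).1 h.2).1 _ hvl, ?_⟩
        rintro ⟨rfl, -⟩
        exact hi _ hvl
      · refine Or.inl ⟨hs.layer.out v l hv (hvi.imp id fun h => ?_) hvl, ?_⟩
        · exact Nat.lt_of_le_of_ne h fun h => hvk (Fin.ext h.symm)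
        · rintro ⟨rfl, rfl⟩
          exact hk _ hvl
  have hsub' : L ∪ s.inputClauses ∪ t.inputClauses ⊆
      L ∪ (ResTree.resolve (X k i) s q).inputClauses :=
    Set.union_subset (Set.union_subset_union_right _ (ResTree.inputClauses_resolve_left _ _ _))
      ((hsub.trans (ResTree.inputClauses_resolve_right _ _ _)).trans Set.subset_union_right)
  refine ⟨.resolve (X k i) s q, ⟨hd, hlayer, fun c d hcd h => ?_, Or.inr ?_⟩, ?_, hsub'⟩
  · have hk1 : ∀ c d : Fin n, (k : ℕ) + 1 ≤ c ∨ (k : ℕ) + 1 ≤ d → (k : ℕ) ≤ c ∨ (k : ℕ) ≤ d :=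
      fun c d h => by omega
    rcases h with h | h | h
    · rcases hX.fst_eq hcd hki h with ⟨rfl, rfl⟩ | ⟨rfl, rfl⟩
      · exact ⟨hi _, hk _, fun _ _ => Or.inl le_rfl⟩
      · exact ⟨hk _, hi _, fun _ _ => Or.inr le_rfl⟩
    · obtain ⟨h1, h2, h3⟩ := hs.resolved c d hcd h
      exact ⟨h1, h2, fun hc hd => hk1 c d (h3 hc hd)⟩
    · rcases h3 c d hcd h with h | ⟨h, rfl⟩ | ⟨h, rfl⟩
      · obtain ⟨h1, h2, h3⟩ := ht.resolved c d hcd h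
        exact ⟨h1, h2, fun hc hd => hk1 c d (h3 hc hd)⟩
      · exact ⟨hk _, ((hJ c).1 h).1 _, fun _ _ => Or.inr le_rfl⟩
      · exact ⟨((hJ d).1 h).1 _, hk _, fun _ _ => Or.inl le_rfl⟩
  · have hle := numLayers_anti (X := X) (F := F) (α := α) hsub'
    have hle' := numLayers_anti (X := X) (F := F) (α := α)
      (Set.subset_union_left (s := L ∪ s.inputClauses) (t := t.inputClauses))
    have hle'' := numLayers_anti (X := X) (F := F) (α := α)
      (Set.subset_union_left (s := L) (t := s.inputClauses))
    -- If both given derivations are leaves, the new tree is an input derivation and its conclusion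
    -- is a new layer; otherwise one of them already contributed a layer.
    rcases hs.progress with hsl | hp
    · rcases ht.progress with htl | hp
      · refine numLayers_lt Set.subset_union_left k.2.le hn ⟨_, Or.inr (Or.inr ?_), hlayer⟩
        have htin : t.IsInput := by
          rw [htl.eq_leaf]
          trivial
        have hsin : s.IsInput := by
          rw [hsl.eq_leaf]
          trivial
        exact ResTree.IsInput.clause_mem (t := .resolve (X k i) s q)
          ⟨Or.inl hsl, hsin, hin htin⟩ fun h => h
      · omega
    · omega
  · have := Finset.card_le_univ J
    simp only [Fintype.card_fin] at this
    simp only [ResTree.resolve, ResTree.size]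
    omega

/-- Amortisation: a derivation that is not a leaf makes some layer available, and a new layer is
charged at most once on each of the `h + 1` levels from `k` to `n`. The charge `2 * n + 2` consists
of the `2 * n + 1` nodes of an elimination step and one more because two premises each have the
additive term 1. -/
theorem GuardedTautology.exists_derivesLayer (hF : GuardedTautology X F) :
    ∀ (h k : ℕ), k + h = n → ∀ (L : Set (Clause V)), IsReady X F L α →
      ∀ i : Fin n, IsSource α i → (i : ℕ) < k → ∃ t, DerivesLayer X F L α k i t ∧
        t.size + (2 * n + 2) * (h + 1) * numLayers X F (L ∪ t.inputClauses) α ≤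
          1 + (2 * n + 2) * (h + 1) * numLayers X F L α := by
  intro h
  induction h with
  | zero =>
    intro k hk L hr i hi _
    obtain rfl : k = n := hk
    by_cases hl : HasLayer X F L α k i
    · obtain ⟨t, ht, hs⟩ := hl.exists_derivesLayer
      exact ⟨t, ht, Nat.add_le_add hs.le
        (Nat.mul_le_mul_left _ (numLayers_anti Set.subset_union_left))⟩
    · obtain ⟨t, ht, hs⟩ := hF.exists_derivesLayer_last hr hi hl
      refine ⟨t, ht, ?_⟩
      rcases ht.progress with hp | hp
      · rw [hp.eq_leaf, ResTree.size]
        exact Nat.add_le_add_left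
          (Nat.mul_le_mul_left _ (numLayers_anti Set.subset_union_left)) _
      · have := Nat.mul_le_mul_left ((2 * k + 2) * (0 + 1)) (Nat.succ_le_of_lt hp)
        rw [Nat.succ_eq_add_one, Nat.mul_add] at this
        simp only [Nat.zero_add, Nat.mul_one] at this ⊢
        omega
  | succ h ih =>
    intro k hk L hr i hi hik
    by_cases hl : HasLayer X F L α k i
    · obtain ⟨t, ht, hs⟩ := hl.exists_derivesLayer
      exact ⟨t, ht, Nat.add_le_add hs.le
        (Nat.mul_le_mul_left _ (numLayers_anti Set.subset_union_left))⟩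
    obtain ⟨s, hs, hssize⟩ := ih (k + 1) (by omega) L hr i hi (by omega)
    have hanti := numLayers_anti (X := X) (F := F) (α := α)
      (Set.subset_union_left (s := L) (t := s.inputClauses))
    lift k to Fin n using (by omega)
    by_cases hks : IsSource α k
    · obtain ⟨t, ht, htsize⟩ := ih (k + 1) (by omega) (L ∪ s.inputClauses)
        (hr.mono Set.subset_union_left) k hks (Nat.lt_succ_self _)
      obtain ⟨r, hrd, hrsize, hsub⟩ := hF.exists_derivesLayer_step hr hks hi hik hl hs ht
      refine ⟨r, hrd, ?_⟩
      have hle := numLayers_anti (X := X) (F := F) (α := α) hsub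
      rcases hrd.progress with hp | hp
      · rw [hp.eq_leaf, ResTree.size]
        exact Nat.add_le_add_left
          (Nat.mul_le_mul_left _ (numLayers_anti Set.subset_union_left)) _
      · have m1 := Nat.mul_le_mul_left ((2 * n + 2) * (h + 1)) hle
        have m2 := Nat.mul_le_mul_left (2 * n + 2) (Nat.succ_le_of_lt hp)
        rw [Nat.succ_eq_add_one, Nat.mul_add, Nat.mul_one] at m2
        have e : ∀ x, (2 * n + 2) * (h + 1 + 1) * x =
          (2 * n + 2) * (h + 1) * x + (2 * n + 2) * x := fun x => by ring
        rw [e, e]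
        omega
    -- If `k` is not a source, the same clause serves for `k + 1` and for `k`.
    · have hlt : ∀ u : Fin n, IsSource α u → (u : ℕ) < k + 1 → (u : ℕ) < k := fun u hu h =>
        lt_of_le_of_ne (Nat.lt_succ_iff.1 h) fun h => hks (Fin.ext h ▸ hu)
      refine ⟨s, ⟨hs.toIsDerivation, ⟨fun u v huv h => ?_, fun u hu hui huk => ?_,
        fun v l hv hvi hvl => ?_⟩, fun c d hcd h => ?_, hs.progress⟩, ?_⟩
      · exact (hs.layer.sub u v huv h).imp id fun ⟨h1, h2, h3⟩ => ⟨h1, h2, hlt u h2 h3⟩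
      · exact hs.layer.mem u hu hui (Nat.lt_succ_of_lt huk)
      · refine hs.layer.out v l hv (hvi.imp id fun h => ?_) hvl
        by_contra hc
        exact absurd (hlt v hv (by omega)) (by omega)
      · obtain ⟨h1, h2, h3⟩ := hs.resolved c d hcd h
        exact ⟨h1, h2, fun hc hd => (h3 hc hd).imp (by omega) (by omega)⟩
      · have m2 := Nat.mul_le_mul_left (2 * n + 2) hanti
        have e : ∀ x, (2 * n + 2) * (h + 1 + 1) * x =
          (2 * n + 2) * (h + 1) * x + (2 * n + 2) * x := fun x => by ring
        rw [e, e]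
        omega

/-- A partial tournament that needs no new transitivity clause can be solved. -/
theorem IsReady.exists_solvesUnder (hF : GuardedTautology X F) (hn : 1 ≤ n)
    (hr : IsReady X F L α) : ∃ t, SolvesUnder X F L α t ∧ t.size ≤ 17 * n ^ 4 := by
  classical
  have hne : (Finset.univ.filter fun i => IsSource α i).Nonempty := by
    rcases hr.covered ⟨0, hn⟩ with h | ⟨p, hp, -⟩
    · exact ⟨_, Finset.mem_filter.2 ⟨Finset.mem_univ _, h⟩⟩
    · exact ⟨_, Finset.mem_filter.2 ⟨Finset.mem_univ _, hp⟩⟩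
  obtain ⟨i, hi, hmin⟩ := Finset.exists_min_image _ id hne
  replace hi := (Finset.mem_filter.1 hi).2
  replace hmin : ∀ j, IsSource α j → i ≤ j := fun j hj =>
    hmin j (Finset.mem_filter.2 ⟨Finset.mem_univ _, hj⟩)
  -- Since `i` is the least source, no other source lies below `i + 1`, so the clause for `i + 1`
  -- and `i` is falsified by `α`.
  obtain ⟨t, ht, hs⟩ := hF.exists_derivesLayer (n - (i + 1)) (i + 1) (by omega) L hr i hi
    (Nat.lt_succ_self _)
  refine ⟨t, ⟨⟨ht.toIsDerivation, fun c d hcd h hres => (ht.resolved c d hcd hres).1 h,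
    fun u v huv h => ?_⟩, fun v l hv hvl => ht.layer.out v l hv ?_ hvl⟩, ?_⟩
  · refine (ht.layer.sub u v huv h).resolve_right ?_
    rintro ⟨rfl, hu, hlt⟩
    exact huv (le_antisymm (Nat.lt_succ_iff.1 hlt) (hmin u hu))
  · by_cases h : v = i
    · exact Or.inl h
    · exact Or.inr (lt_of_le_of_ne (hmin v hv) (Ne.symm h))
  · have h1 : t.size ≤ 1 + (2 * n + 2) * (n - (i + 1) + 1) * numLayers X F L α :=
      (Nat.le_add_right _ _).trans hs
    have h2 : (2 * n + 2) * (n - (i + 1) + 1) * numLayers X F L α ≤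
        (4 * n) * n * ((2 * n) * n) :=
      Nat.mul_le_mul (Nat.mul_le_mul (by omega) (by omega))
        (numLayers_le.trans (Nat.mul_le_mul_right _ (by omega)))
    have h3 : (4 * n) * n * ((2 * n) * n) = 8 * n ^ 4 := by ring
    have h4 : 1 ≤ n ^ 4 := Nat.one_le_pow _ _ hn
    omega

/-- A guarded tautology has a refutation of size `O(n ^ 7)`. -/
theorem GuardedTautology.exists_refutation (hF : GuardedTautology X F) (hn : 1 ≤ n)
    (hsurj : ∀ ℓ : Literal V, ∃ i j, i ≠ j ∧ ℓ = X i j) :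
    ∃ t : ResTree V, t.IsRegRTIRefutation F ∧ t.size ≤ 69 * n ^ 7 := by
  have h1 : n ≤ n ^ 4 := Nat.le_self_pow (by norm_num) n
  -- The value 52 is `2 * 17 + 12 + 6`, using `n ≤ n ^ 4`. The start is the graph without arcs,
  -- where every vertex is a source.
  obtain ⟨t, ht, hs⟩ := canSolve_of_forall_available hF (A := 17 * n ^ 4) (B := 52 * n ^ 4)
    (by omega) (fun L α hirr hcov h1 h2 => IsReady.exists_solvesUnder hF hn ⟨hirr, hcov, h1, h2⟩)
    _ ∅ (fun _ _ => False) le_rfl (fun _ h => h) (fun _ => Or.inl fun _ h => h)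
  refine ⟨t, ⟨ht.leaves, ht.inferences, ht.regular, ?_⟩, ?_⟩
  · refine Finset.eq_empty_of_forall_notMem fun ℓ hℓ => ?_
    obtain ⟨i, j, hij, rfl⟩ := hsurj ℓ
    exact ht.falsified i j hij hℓ
  · have h2 : t.size ≤ 17 * n ^ 4 + 52 * n ^ 4 * n ^ 3 :=
      ((Nat.le_add_right _ _).trans hs).trans
        (Nat.add_le_add_left (Nat.mul_le_mul_left _ (numUnlearned_le _)) _)
    have h3 : n ^ 4 ≤ n ^ 7 := Nat.pow_le_pow_right hn (by norm_num)
    have h4 : 52 * n ^ 4 * n ^ 3 = 52 * n ^ 7 := by ring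
    omega

end GGTRes

namespace GGTRes

/-! ### Guarded graph tautologies -/

theorem x_inj {n : ℕ} {i j k l : Fin n} (hij : i ≠ j) (hkl : k ≠ l) (h : x i j hij = x k l hkl) :
    i = k ∧ j = l := by
  unfold x at h
  split_ifs at h <;> simp at h
  · exact h
  · exact h.symm

/-- The literal `x i j` as a total function; `e` provides the values on the diagonal. -/
def pairLiteral {n : ℕ} (e : Literal (Edge n)) (i j : Fin n) : Literal (Edge n) :=
  if h : i ≠ j then x i j h else e

theorem pairLiteral_of_ne {n : ℕ} (e : Literal (Edge n)) {i j : Fin n} (h : i ≠ j) :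
    pairLiteral e i j = x i j h :=
  dif_pos h

theorem orderLiterals_pairLiteral {n : ℕ} (e : Literal (Edge n)) :
    OrderLiterals (pairLiteral e) where
  neg i j h := by rw [pairLiteral_of_ne e h, pairLiteral_of_ne e h.symm, neg_x]
  inj i j k l h h' heq := by
    rw [pairLiteral_of_ne e h, pairLiteral_of_ne e h'] at heq
    exact x_inj h h' heq

theorem exists_eq_pairLiteral {n : ℕ} (e ℓ : Literal (Edge n)) :
    ∃ i j, i ≠ j ∧ ℓ = pairLiteral e i j := by
  obtain ⟨⟨⟨i, j⟩, hij⟩, b⟩ := ℓ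
  replace hij : i < j := hij
  cases b
  · exact ⟨j, i, hij.ne', by simp [pairLiteral_of_ne e hij.ne', x, not_lt.2 hij.le]⟩
  · exact ⟨i, j, hij.ne, by simp [pairLiteral_of_ne e hij.ne, x, hij]⟩

theorem guardedTautology_GGT {n : ℕ} (e : Literal (Edge n)) (g : Guards n) :
    GuardedTautology (pairLiteral e) (GGT g) where
  lits := orderLiterals_pairLiteral e
  notMinimal i := by
    refine ⟨notMinimal i, Or.inl ⟨i, rfl⟩, fun u v huv => ?_⟩
    simp only [notMinimal, Finset.mem_image, Finset.mem_univ, true_and, Subtype.exists,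
      pairLiteral_of_ne e huv]
    constructor
    · rintro ⟨j, hj, h⟩
      exact (x_inj hj huv h).2.symm
    · rintro rfl
      exact ⟨u, huv, rfl⟩
  guarded a b c hab hbc hca := by
    have hT : cycleClause (pairLiteral e) a b c = trans a b c hab hbc hca := by
      simp only [cycleClause, trans, neg_x, pairLiteral_of_ne e hab.symm,
        pairLiteral_of_ne e hbc.symm, pairLiteral_of_ne e hca.symm]
    have hne := g.ne a b c hab hbc hca
    refine ⟨g.r a b c, g.s a b c, hne, fun h => ?_, ?_, ?_⟩
    · refine g.not_subset a b c hab hbc hca ?_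
      rintro y (rfl | rfl)
      · exact h.1
      · exact h.2
    · rw [hT, pairLiteral_of_ne e hne]
      exact Or.inr ⟨a, b, c, hab, hbc, hca, Or.inl rfl⟩
    · rw [hT, pairLiteral_of_ne e hne.symm, ← neg_x _ _ hne]
      exact Or.inr ⟨a, b, c, hab, hbc, hca, Or.inr rfl⟩

theorem exists_isRegRTIRefutation_GGT {n : ℕ} (hn : 1 ≤ n) (g : Guards n) :
    ∃ T : ResTree (Edge n), T.IsRegRTIRefutation (GGT g) ∧ T.size ≤ 69 * n ^ 7 := by
  -- For `n = 1` there is no literal to serve as diagonal value, but the only `notMinimal` clause is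
  -- already empty.
  rcases hn.eq_or_lt with rfl | hn'
  · refine ⟨.leaf ∅, ⟨Or.inl (Or.inl ⟨0, ?_⟩), trivial, trivial, rfl⟩, by simp [ResTree.size]⟩
    refine (Finset.eq_empty_of_forall_notMem fun ℓ hℓ => ?_).symm
    obtain ⟨⟨j, hj⟩, -⟩ := Finset.mem_image.1 hℓ
    exact hj (Subsingleton.elim _ _)
  · let e : Literal (Edge n) := (⟨(⟨0, hn⟩, ⟨1, hn'⟩), by simp [Fin.lt_def]⟩, true)
    exact (guardedTautology_GGT e g).exists_refutation hn (exists_eq_pairLiteral e)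

end GGTRes

theorem mainTheorem2 :
    (∃ K : ℕ, ∀ n : ℕ, 1 ≤ n → ∀ g : GGTRes.Guards n,
      ∃ T : GGTRes.ResTree (GGTRes.Edge n),
        T.IsRegRTIRefutation (GGTRes.GGT g) ∧ T.size ≤ K * n ^ 7) ∧
    (∃ p : Polynomial ℕ, ∀ n : ℕ, 1 ≤ n → ∀ g : GGTRes.Guards n,
      ∃ S : GGTRes.Search (GGTRes.Edge n),
        S.Refutes (GGTRes.GGT g) ∅ ∧ S.size ≤ p.eval n) := by
  refine ⟨⟨69, fun n hn g => GGTRes.exists_isRegRTIRefutation_GGT hn g⟩,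
    -- Each node of the tree costs at most one call and one learned clause, hence `138 = 2 * 69`.
    .C 138 * .X ^ 7, fun n hn g => ?_⟩
  obtain ⟨T, hT, hs⟩ := GGTRes.exists_isRegRTIRefutation_GGT hn g
  obtain ⟨S, hS, hsize, -⟩ := T.exists_search subset_rfl (Set.empty_subset _) hT.leaves
    hT.inferences hT.regular (α := ∅) (by simp) (by simp [hT.root])
  refine ⟨S, hS, ?_⟩
  simp only [Polynomial.eval_mul, Polynomial.eval_C, Polynomial.eval_pow, Polynomial.eval_X]
  omega
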